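/- **Notation.** Let $n\ge 1$, let ${}^{c}B(0,t)=\{x\in\mathbb R^n: |x|\ge t\}$ for $t>0$, and let $\mathfrak M^+(\mathbb R^n)$ be the set of all measurable functions $f:\mathbb R^n\to[0,\infty]$. A weight on an open set $\Omega$ is a non-negative locally integrable function on $\Omega$. For $f\ge 0$ and a weight $w$ put $\|f\|_{p,w,\Omega}=\big(\int_\Omega f^p w\big)^{1/p}$ if $0<p<\infty$ and $\|f\|_{\infty,w,\Omega}=\operatorname{ess\,sup}_{\Omega} f w$; write $\|f\|_{p,\Omega}$ if $w\equiv1$. Put $1/p+1/p'=1$ (so $1'=\infty$, $\infty'=1$), $0\cdot\infty=0$, and $v^{-s}=\infty$ where $v=0$ (for $s>0$). **Theorem.** Let $1\le p_2\le\infty$, $0<q<\infty$, let $u$ be a weight on $(0,\infty)$ and let $v_1,v_2$ be weights on $\mathbb R^n$. Consider the inequality $$\bigg(\int_0^\infty\Big(\int_{{}^{c}B(0,t)} f\cdot\int_{{}^{c}B(0,t)} g\Big)^q u(t)\,dt\bigg)^{1/q}\le C\,\|f\|_{\infty,v_1,\mathbb R^n}\,\|g\|_{p_2,v_2,\mathbb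 R^n},\qquad f,g\in\mathfrak M^+(\mathbb R^n). \tag{$*$}$$ (i) If $p_2\le q$, then $(*)$ holds with some finite $C$ for all $f,g\in\mathfrak M^+(\mathbb R^n)$ if and only if $$D_1:=\sup_{t\in(0,\infty)}\bigg(\int_0^{t}u(y)\,\|v_1^{-1}\|_{1,{}^{c}B(0,y)}^q\,dy\bigg)^{1/q}\big\|v_2^{-1/p_2}\big\|_{p_2',{}^{c}B(0,t)}<\infty ,$$ and the best constant $C$ in $(*)$ satisfies $C\approx D_1$. (ii) If $q<p_2<\infty$ and $1/r_2=1/q-1/p_2$, then $(*)$ holds with some finite $C$ for all $f,g\in\mathfrak M^+(\mathbb R^n)$ if and only if $$D_2:=\bigg(\int_0^\infty\Big(\int_0^t u(\tau)\,\|v_1^{-1}\|_{1,{}^{c}B(0,\tau)}^q\,d\tau\Big)^{r_2/p_2}u(t)\,\|v_1^{-1}\|_{1,{}^{c}B(0,t)}^q\,\big\|v_2^{-1/p_2}\big\|_{p_2',{}^{c}B(0,t)}^{r_2}\,dt\bigg)^{1/r_2}<\infty ,$$ and the best constant $C$ in $(*)$ satisfies $C\approx D_2$. (iii) If $p_2=\infty$,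 then $(*)$ holds with some finite $C$ for all $f,g\in\mathfrak M^+(\mathbb R^n)$ if and only if $$D_3:=\bigg(\int_0^\infty u(t)\,\|v_1^{-1}\|_{1,{}^{c}B(0,t)}^q\,\|v_2^{-1}\|_{1,{}^{c}B(0,t)}^q\,dt\bigg)^{1/q}<\infty ,$$ and the best constant $C$ in $(*)$ satisfies $C\approx D_3$. Here the best constant is the infimum of all finite $C$ for which $(*)$ holds for all $f,g$ ($\infty$ if there is none), and $C\approx D$ means $c_1D\le C\le c_2D$ with constants $c_1,c_2\in(0,\infty)$ depending only on $q$ and $p_2$. -/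

import Mathlib

open MeasureTheory
open scoped ENNReal NNReal

namespace BilinearHardy

/-- A weight on `Ω`: a non-negative function that is locally integrable on `Ω`
with respect to Lebesgue measure. -/
structure IsWeight {α : Type*} [TopologicalSpace α] [MeasureSpace α]
    (Ω : Set α) (w : α → ℝ) : Prop where
  nonneg : ∀ x ∈ Ω, 0 ≤ w x
  locallyIntegrableOn : LocallyIntegrableOn w Ω volume

/-- The functional `‖f‖_{p,w,Ω}` for non-negative `f` and `w`: it is `(∫_Ω f ^ p w) ^ (1 / p)` for
`p < ∞` and `ess sup_Ω f w` for `p = ∞`. In `ℝ≥0∞` we have `0 * ∞ = 0`. -/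
noncomputable def weightedNorm {α : Type*} [MeasureSpace α] (p : ℝ≥0∞) (w : α → ℝ≥0∞) (Ω : Set α)
    (f : α → ℝ≥0∞) : ℝ≥0∞ :=
  if p = ∞ then essSup (fun x => f x * w x) (volume.restrict Ω)
  else (∫⁻ x in Ω, f x ^ p.toReal * w x) ^ (1 / p.toReal)

/-- The complement of the open ball `B(0,t)` of `ℝⁿ`. -/
def ballCompl (n : ℕ) (t : ℝ) : Set (EuclideanSpace ℝ (Fin n)) := (Metric.ball 0 t)ᶜ

/-- The quantity `‖v ^ (-s)‖_{p, ᶜB(0,t)}` (with weight one); `v ^ (-s) = ∞` where `v = 0`, `s > 0`. -/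
noncomputable def negPowNorm {n : ℕ} (p : ℝ≥0∞) (s : ℝ) (v : EuclideanSpace ℝ (Fin n) → ℝ)
    (t : ℝ) : ℝ≥0∞ :=
  weightedNorm p (fun _ => 1) (ballCompl n t) (fun x => ENNReal.ofReal (v x) ^ (-s))

/-- The left-hand side
`(∫_0^∞ (∫_{ᶜB(0,t)} f · ∫_{ᶜB(0,t)} g) ^ q u(t) dt) ^ (1 / q)`. -/
noncomputable def bilinearLHS {n : ℕ} (q : ℝ) (u : ℝ → ℝ)
    (f g : EuclideanSpace ℝ (Fin n) → ℝ≥0∞) : ℝ≥0∞ :=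
  (∫⁻ t in Set.Ioi (0 : ℝ),
    ((∫⁻ x in ballCompl n t, f x) * ∫⁻ x in ballCompl n t, g x) ^ q * ENNReal.ofReal (u t)) ^ (1 / q)

/-- The bilinear Hardy inequality with constant `C`, for all non-negative (Lebesgue) measurable
functions `f`, `g` on `ℝⁿ`. -/
def HardyIneq {n : ℕ} (q : ℝ) (p₁ p₂ : ℝ≥0∞) (u : ℝ → ℝ) (v₁ v₂ : EuclideanSpace ℝ (Fin n) → ℝ)
    (C : ℝ≥0) : Prop :=
  ∀ f g : EuclideanSpace ℝ (Fin n) → ℝ≥0∞, AEMeasurable f volume → AEMeasurable g volume →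
    bilinearLHS q u f g ≤
      C * weightedNorm p₁ (fun x => ENNReal.ofReal (v₁ x)) Set.univ f
        * weightedNorm p₂ (fun x => ENNReal.ofReal (v₂ x)) Set.univ g

/-- The best constant: the infimum of all finite admissible constants, `∞` if there is none. -/
noncomputable def bestConstant {n : ℕ} (q : ℝ) (p₁ p₂ : ℝ≥0∞) (u : ℝ → ℝ)
    (v₁ v₂ : EuclideanSpace ℝ (Fin n) → ℝ) : ℝ≥0∞ :=
  ⨅ (C : ℝ≥0) (_ : HardyIneq q p₁ p₂ u v₁ v₂ C), (C : ℝ≥0∞)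

/-- `D₁ = sup_{t > 0} (∫_0^t u(y) ‖v₁⁻¹‖_{1,ᶜB(0,y)} ^ q dy) ^ (1 / q) ‖v₂ ^ (-1 / p₂)‖_{p₂',ᶜB(0,t)}`. -/
noncomputable def D₁ {n : ℕ} (q : ℝ) (p₂ : ℝ≥0∞) (u : ℝ → ℝ)
    (v₁ v₂ : EuclideanSpace ℝ (Fin n) → ℝ) : ℝ≥0∞ :=
  ⨆ t ∈ Set.Ioi (0 : ℝ),
    (∫⁻ y in Set.Ioo 0 t, ENNReal.ofReal (u y) * negPowNorm 1 1 v₁ y ^ q) ^ (1 / q)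
      * negPowNorm p₂.conjExponent (1 / p₂.toReal) v₂ t

/-- `D₂ = (∫_0^∞ (∫_0^t u(τ) ‖v₁⁻¹‖_{1,ᶜB(0,τ)} ^ q dτ) ^ (r₂ / p₂)
u(t) ‖v₁⁻¹‖_{1,ᶜB(0,t)} ^ q ‖v₂ ^ (-1 / p₂)‖_{p₂',ᶜB(0,t)} ^ r₂ dt) ^ (1 / r₂)`. -/
noncomputable def D₂ {n : ℕ} (q : ℝ) (p₂ : ℝ≥0∞) (r₂ : ℝ) (u : ℝ → ℝ)
    (v₁ v₂ : EuclideanSpace ℝ (Fin n) → ℝ) : ℝ≥0∞ :=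
  (∫⁻ t in Set.Ioi (0 : ℝ),
    (∫⁻ τ in Set.Ioo 0 t, ENNReal.ofReal (u τ) * negPowNorm 1 1 v₁ τ ^ q) ^ (r₂ / p₂.toReal)
      * ENNReal.ofReal (u t) * negPowNorm 1 1 v₁ t ^ q
      * negPowNorm p₂.conjExponent (1 / p₂.toReal) v₂ t ^ r₂) ^ (1 / r₂)

/-- `D₃ = (∫_0^∞ u(t) ‖v₁⁻¹‖_{1,ᶜB(0,t)} ^ q ‖v₂⁻¹‖_{1,ᶜB(0,t)} ^ q dt) ^ (1 / q)`. -/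
noncomputable def D₃ {n : ℕ} (q : ℝ) (u : ℝ → ℝ)
    (v₁ v₂ : EuclideanSpace ℝ (Fin n) → ℝ) : ℝ≥0∞ :=
  (∫⁻ t in Set.Ioi (0 : ℝ),
    ENNReal.ofReal (u t) * negPowNorm 1 1 v₁ t ^ q * negPowNorm 1 1 v₂ t ^ q) ^ (1 / q)

end BilinearHardy

/-!
For fixed `g` the best choice of `f` with `‖f‖_{∞, v₁} ≤ 1` is `f = v₁⁻¹`. Hence the bilinear
inequality is equivalent to the Hardy inequality
`(∫ (∫_{|x| ≥ t} g) ^ q dω(t)) ^ (1 / q) ≤ C ‖g‖_{p₂, v₂}` for the measure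
`ω = u(t) ‖v₁⁻¹‖_{1, ᶜB(0,t)} ^ q dt` (`HardyIneq.lintegral_rpow_le`,
`hardyIneq_of_lintegral_rpow_le`). For `p₂ = ∞` the same argument applies to `g`, and the best
constant is exactly `D₃`.

For `p = p₂ < ∞` write `Ω(t) = ω(Iio t)` and `V(t) = ‖v₂ ^ (-1 / p)‖_{p', ᶜB(0,t)}`; then
`D₁ = sup Ω ^ (1 / q) V` and `D₂ ^ r = ∫ Ω ^ (r / p) V ^ r dω`.

*Sufficiency.* Let `G(t) = ∫_{|x| ≥ t} g`. The points `x` with `2 ^ (k - 1) < G(|x|) ≤ 2 ^ k` lie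
to the right of every `t` with `2 ^ k < G(t) ≤ 2 ^ (k + 1)`, and since spheres are null sets, `g`
has integral at least `2 ^ (k - 1)` over them. Hölder's inequality on this shell bounds `G(t)` by
`4 V(t)` times the norm of `g` on the shell. The shells are disjoint, so the bounds can be added:
directly for `p ≤ q` (`lintegral_measure_Ici_rpow_le_of_le`), with Hölder's inequality for sums
for `q < p` (`lintegral_measure_Ici_rpow_le_of_lt`), where in addition
`ω(S) ^ (r / q) ≤ 2 ^ (r / q) ∫_S Ω ^ (r / p) dω` is used (`rpow_half_measure_univ_le_lintegral`).

*Necessity.* Almost extremal functions in Hölder's inequality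
(`exists_le_setLIntegral_of_lt_dualNorm`) on `{|x| ≥ t}` give `Ω(t) ^ (1 / q) V(t) ≤ C`. For
`q < p` the line is cut into the dyadic levels of `Ω`, and an `ℓ ^ p` combination of almost
extremal functions, one for each level, gives the bound for `D₂`
(`lintegral_rpow_measure_Iio_mul_dualNorm_le`). Both arguments include `p = 1`.

The zeros of the weights need care because `0 * ∞ = 0`: Hölder's inequality fails in `ℝ≥0∞` when
the dual norm is infinite. Finiteness of `D₁`, `D₂`, `D₃` confines that to null sets of `ω`,
respectively of `u(t) dt`.
-/

namespace BilinearHardy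

/-! ### Measures on the line without atoms -/

theorem monotone_measure_Iio {α : Type*} [Preorder α] [MeasurableSpace α] (μ : Measure α) :
    Monotone fun t => μ (Set.Iio t) :=
  fun _ _ h => measure_mono (Set.Iio_subset_Iio h)

section Atomless

variable {α : Type*} [LinearOrder α] [TopologicalSpace α] [OrderTopology α]
  [SecondCountableTopology α] [MeasurableSpace α]

/-- If `S` has a greatest element `m`, it lies in `Iic m`, which has the measure of `Iio m`.
Otherwise `S` is covered by the `Iio t` with `t ∈ S`, and countably many of them suffice by the
Lindelöf property; so no finiteness of `μ` is needed. -/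
theorem measure_le_of_forall_measure_Iio_le {μ : Measure α} [NullSingletonClass μ] {S : Set α}
    {c : ℝ≥0∞} (h : ∀ t ∈ S, μ (Set.Iio t) ≤ c) : μ S ≤ c := by
  by_cases hm : ∃ m ∈ S, ∀ s ∈ S, s ≤ m
  · obtain ⟨m, hmS, hm⟩ := hm
    calc μ S ≤ μ (Set.Iic m) := measure_mono hm
      _ = μ (Set.Iio m) := (measure_congr Iio_ae_eq_Iic).symm
      _ ≤ c := h m hmS
  · push Not at hm
    obtain ⟨T, hTS, hTc, hT⟩ := TopologicalSpace.isOpen_biUnion_countable S Set.Iio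
      fun _ _ => isOpen_Iio
    calc μ S ≤ μ (⋃ t ∈ T, Set.Iio t) := by
          refine measure_mono fun s hs => ?_
          obtain ⟨s', hs', hlt⟩ := hm s hs
          rw [hT]
          exact Set.mem_biUnion hs' hlt
      _ = ⨆ t ∈ T, μ (Set.Iio t) := by
          refine measure_biUnion_eq_iSup hTc fun a ha b hb => ?_
          rcases le_total a b with hab | hab
          · exact ⟨b, hb, Set.Iio_subset_Iio hab, subset_rfl⟩
          · exact ⟨a, ha, subset_rfl, Set.Iio_subset_Iio hab⟩
      _ ≤ c := iSup₂_le fun t ht => h t (hTS ht)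

theorem measure_le_of_forall_measure_Ioi_le {μ : Measure α} [hμ : NullSingletonClass μ] {S : Set α}
    {c : ℝ≥0∞} (h : ∀ t ∈ S, μ (Set.Ioi t) ≤ c) : μ S ≤ c :=
  @measure_le_of_forall_measure_Iio_le αᵒᵈ _ _ _ _ _ μ hμ S c h

theorem measure_setOf_measure_Ici_le {μ : Measure α} [NullSingletonClass μ] (a : ℝ≥0∞) :
    μ {s | μ (Set.Ici s) ≤ a} ≤ a :=
  measure_le_of_forall_measure_Ioi_le fun _ ht =>
    (measure_mono Set.Ioi_subset_Ici_self).trans ht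

theorem measure_setOf_measure_Iio_le {μ : Measure α} [NullSingletonClass μ] (a : ℝ≥0∞) :
    μ {s | μ (Set.Iio s) ≤ a} ≤ a :=
  measure_le_of_forall_measure_Iio_le fun _ ht => ht

variable [BorelSpace α]

/-- Together with `measure_setOf_measure_Iio_le`: the distribution function `s ↦ μ (Iio s)` of a
measure without atoms carries `μ` to Lebesgue measure, as long as its values stay finite. This
replaces the choice of points at which a distribution function takes prescribed values. -/
theorem le_measure_setOf_measure_Iio_le {μ : Measure α} [NullSingletonClass μ] {a : ℝ≥0∞} {t : α}
    (ha : a ≤ μ (Set.Iio t)) (ht : μ (Set.Iio t) ≠ ∞) :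
    a ≤ μ {s | μ (Set.Iio s) ≤ a} := by
  set B : Set α := {s | a < μ (Set.Iio s)} with hB
  have hBm : MeasurableSet B :=
    measurableSet_lt measurable_const (monotone_measure_Iio μ).measurable
  have h1 : μ.restrict (Set.Iio t) B ≤ μ (Set.Iio t) - a := by
    refine measure_le_of_forall_measure_Ioi_le fun s hs => ?_
    rw [Measure.restrict_apply measurableSet_Ioi]
    have hsub : Set.Ioi s ∩ Set.Iio t ⊆ Set.Iio t \ Set.Iio s :=
      fun x hx => ⟨hx.2, not_lt.2 (le_of_lt hx.1)⟩
    rcases le_total s t with hst | hst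
    · calc μ (Set.Ioi s ∩ Set.Iio t) ≤ μ (Set.Iio t \ Set.Iio s) := measure_mono hsub
        _ = μ (Set.Iio t) - μ (Set.Iio s) :=
          measure_sdiff (Set.Iio_subset_Iio hst) measurableSet_Iio.nullMeasurableSet
            (ne_top_of_le_ne_top ht (measure_mono (Set.Iio_subset_Iio hst)))
        _ ≤ μ (Set.Iio t) - a := tsub_le_tsub_left (le_of_lt hs) _
    · have : Set.Ioi s ∩ Set.Iio t = ∅ :=
        Set.eq_empty_of_forall_notMem fun x hx => absurd (hx.1.trans hx.2) (not_lt.2 hst)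
      simp [this]
  rw [Measure.restrict_apply hBm] at h1
  have h2 : μ (Set.Iio t) ≤ μ {s | μ (Set.Iio s) ≤ a} + (μ (Set.Iio t) - a) := by
    refine le_trans (measure_mono fun x hx => ?_) ((measure_union_le _ (B ∩ Set.Iio t)).trans
      (add_le_add_right h1 _))
    rcases le_or_gt (μ (Set.Iio x)) a with h | h
    · exact Or.inl h
    · exact Or.inr ⟨h, hx⟩
  have h3 : a + (μ (Set.Iio t) - a) ≤ μ {s | μ (Set.Iio s) ≤ a} + (μ (Set.Iio t) - a) := by
    rwa [add_tsub_cancel_of_le ha]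
  exact (ENNReal.add_le_add_iff_right (ne_top_of_le_ne_top ht tsub_le_self)).1 h3

theorem le_measure_setOf_measure_Ici_le {μ : Measure α} [hμ : NullSingletonClass μ] {a : ℝ≥0∞}
    {t : α} (ha : a ≤ μ (Set.Ici t)) (ht : μ (Set.Ici t) ≠ ∞) :
    a ≤ μ {s | μ (Set.Ici s) ≤ a} := by
  have h (s : α) : μ (Set.Ici s) = μ (Set.Ioi s) := (measure_congr Ioi_ae_eq_Ici).symm
  simp only [h] at ha ht ⊢
  exact @le_measure_setOf_measure_Iio_le αᵒᵈ _ _ _ _ _ _ μ hμ a t ha ht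

/-- For `μ = W dt` this is the inequality
`(∫ W) ^ (1 + s) ≤ c ∫ W(t) (∫_{τ < t} W(τ) dτ) ^ s dt`. No differentiation is involved: at least
half of the mass sits where `μ (Iio t)` is at least half of the total mass. -/
theorem rpow_half_measure_univ_le_lintegral (μ : Measure α) [NullSingletonClass μ] {s : ℝ}
    (hs : 0 ≤ s) :
    (μ Set.univ / 2) ^ (1 + s) ≤ ∫⁻ t, μ (Set.Iio t) ^ s ∂μ := by
  have key (a : ℝ≥0∞) (ha : a ≠ ∞) (h2 : 2 * a ≤ μ Set.univ) :
      a ^ (1 + s) ≤ ∫⁻ t, μ (Set.Iio t) ^ s ∂μ := by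
    have hm : MeasurableSet {t | a ≤ μ (Set.Iio t)} :=
      measurableSet_le measurable_const (monotone_measure_Iio μ).measurable
    have h1 : μ {t | a ≤ μ (Set.Iio t)}ᶜ ≤ a :=
      measure_le_of_forall_measure_Iio_le fun t ht => le_of_lt (not_le.1 ht)
    have h3 : a ≤ μ {t | a ≤ μ (Set.Iio t)} := by
      refine (ENNReal.add_le_add_iff_right ha).1 ?_
      calc a + a = 2 * a := (two_mul a).symm
        _ ≤ μ Set.univ := h2
        _ = μ {t | a ≤ μ (Set.Iio t)} + μ {t | a ≤ μ (Set.Iio t)}ᶜ :=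
          (measure_add_measure_compl hm).symm
        _ ≤ _ := by gcongr
    calc a ^ (1 + s) = a ^ s * a := by
          rw [add_comm, ENNReal.rpow_add_of_nonneg _ _ hs zero_le_one, ENNReal.rpow_one]
      _ ≤ a ^ s * μ {t | a ≤ μ (Set.Iio t)} := by gcongr
      _ = ∫⁻ _ in {t | a ≤ μ (Set.Iio t)}, a ^ s ∂μ := by simp
      _ ≤ ∫⁻ t in {t | a ≤ μ (Set.Iio t)}, μ (Set.Iio t) ^ s ∂μ :=
          setLIntegral_mono' hm fun t ht => ENNReal.rpow_le_rpow ht hs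
      _ ≤ _ := setLIntegral_le_lintegral _ _
  by_cases hM : μ Set.univ = ∞
  · have hs1 : (0 : ℝ) < 1 + s := by linarith
    have : ∫⁻ t, μ (Set.Iio t) ^ s ∂μ = ∞ := by
      refine ENNReal.eq_top_of_forall_nnreal_le fun b => ?_
      have := key ((b : ℝ≥0∞) ^ (1 / (1 + s))) (by finiteness) (by simp [hM])
      rwa [← ENNReal.rpow_mul, one_div_mul_cancel hs1.ne', ENNReal.rpow_one] at this
    simp [this]
  · exact key _ (ENNReal.div_ne_top hM two_ne_zero) (ENNReal.mul_div_le)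

end Atomless

/-! ### Dyadic levels of distribution functions -/

/-- The set where `2 ^ k < φ ≤ 2 ^ (k + 1)`. -/
def dyadicLevel (φ : ℝ → ℝ≥0∞) (k : ℤ) : Set ℝ := {t | φ t ∈ Set.Ioc (2 ^ k) (2 ^ (k + 1))}

theorem ennreal_two_zpow_add_one (k : ℤ) : (2 : ℝ≥0∞) ^ (k + 1) = 2 ^ k + 2 ^ k := by
  rw [ENNReal.zpow_add two_ne_zero ENNReal.ofNat_ne_top, zpow_one, mul_two]

theorem ennreal_two_zpow_ne_top (k : ℤ) : (2 : ℝ≥0∞) ^ k ≠ ∞ :=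
  ENNReal.zpow_ne_top two_ne_zero ENNReal.ofNat_ne_top k

theorem ennreal_two_zpow_ne_zero (k : ℤ) : (2 : ℝ≥0∞) ^ k ≠ 0 :=
  (ENNReal.zpow_pos two_ne_zero ENNReal.ofNat_ne_top k).ne'

theorem measurableSet_dyadicLevel {φ : ℝ → ℝ≥0∞} (hφ : Measurable φ) (k : ℤ) :
    MeasurableSet (dyadicLevel φ k) := hφ measurableSet_Ioc

theorem pairwise_disjoint_dyadicLevel (φ : ℝ → ℝ≥0∞) :
    Pairwise (Function.onFun Disjoint (dyadicLevel φ)) := by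
  have h (j k : ℤ) (hjk : j < k) (t : ℝ) (hj : t ∈ dyadicLevel φ j) (hk : t ∈ dyadicLevel φ k) :
      False := by
    have : (2 : ℝ≥0∞) ^ (j + 1) ≤ 2 ^ k :=
      ENNReal.zpow_le_of_le one_le_two (by omega)
    exact absurd (hk.1.trans_le (hj.2.trans this)) (lt_irrefl _)
  intro j k hjk
  refine Set.disjoint_left.2 fun t hj hk => ?_
  rcases lt_or_gt_of_ne hjk with hlt | hlt
  · exact h j k hlt t hj hk
  · exact h k j hlt t hk hj

theorem lintegral_le_tsum_dyadicLevel {ω : Measure ℝ} {φ ψ : ℝ → ℝ≥0∞} (hφ : Measurable φ)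
    (h : ∀ᵐ t ∂ω, ψ t ≠ 0 → φ t ≠ 0 ∧ φ t ≠ ∞) :
    ∫⁻ t, ψ t ∂ω ≤ ∑' k, ∫⁻ t in dyadicLevel φ k, ψ t ∂ω := by
  calc ∫⁻ t, ψ t ∂ω ≤ ∫⁻ t, (⋃ k, dyadicLevel φ k).indicator ψ t ∂ω := by
        refine lintegral_mono_ae (h.mono fun t ht => ?_)
        by_cases h0 : ψ t = 0
        · simp [h0]
        · obtain ⟨k, hk⟩ := ENNReal.exists_mem_Ioc_zpow (ht h0).1 (ht h0).2 ENNReal.one_lt_two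
            ENNReal.ofNat_ne_top
          rw [Set.indicator_of_mem (Set.mem_iUnion.2 ⟨k, hk⟩)]
    _ = ∫⁻ t in ⋃ k, dyadicLevel φ k, ψ t ∂ω :=
        lintegral_indicator (MeasurableSet.iUnion fun k => measurableSet_dyadicLevel hφ k) _
    _ ≤ _ := lintegral_iUnion_le _ _

/-- The two hypotheses hold for the distribution functions `s ↦ μ (Iio s)` and `s ↦ μ (Ici s)` of a
measure without atoms, once the level `k + 1` is nonempty. -/
theorem zpow_le_measure_dyadicLevel {μ : Measure ℝ} {φ : ℝ → ℝ≥0∞} {k : ℤ}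
    (h1 : 2 ^ (k + 1) ≤ μ {t | φ t ≤ 2 ^ (k + 1)}) (h2 : μ {t | φ t ≤ 2 ^ k} ≤ 2 ^ k) :
    2 ^ k ≤ μ (dyadicLevel φ k) := by
  refine (ENNReal.add_le_add_iff_right (ennreal_two_zpow_ne_top k)).1 ?_
  calc (2 : ℝ≥0∞) ^ k + 2 ^ k = 2 ^ (k + 1) := (ennreal_two_zpow_add_one k).symm
    _ ≤ μ {t | φ t ≤ 2 ^ (k + 1)} := h1
    _ ≤ μ (dyadicLevel φ k ∪ {t | φ t ≤ 2 ^ k}) := by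
        refine measure_mono fun t ht => ?_
        rcases le_or_gt (φ t) (2 ^ k) with h | h
        · exact Or.inr h
        · exact Or.inl ⟨h, ht⟩
    _ ≤ μ (dyadicLevel φ k) + μ {t | φ t ≤ 2 ^ k} := measure_union_le _ _
    _ ≤ _ := by gcongr

theorem zpow_le_measure_dyadicLevel_Ici {ν : Measure ℝ} [NullSingletonClass ν] {k : ℤ} {t : ℝ}
    (ht : t ∈ dyadicLevel (fun t => ν (Set.Ici t)) (k + 1)) :
    2 ^ k ≤ ν (dyadicLevel (fun t => ν (Set.Ici t)) k) :=
  zpow_le_measure_dyadicLevel (le_measure_setOf_measure_Ici_le (le_of_lt ht.1)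
    (ne_top_of_le_ne_top (ennreal_two_zpow_ne_top _) ht.2)) (measure_setOf_measure_Ici_le _)

theorem zpow_le_measure_dyadicLevel_Iio {ω : Measure ℝ} [NullSingletonClass ω] {k : ℤ} {t : ℝ}
    (ht : t ∈ dyadicLevel (fun t => ω (Set.Iio t)) (k + 1)) :
    2 ^ k ≤ ω (dyadicLevel (fun t => ω (Set.Iio t)) k) :=
  zpow_le_measure_dyadicLevel (le_measure_setOf_measure_Iio_le (le_of_lt ht.1)
    (ne_top_of_le_ne_top (ennreal_two_zpow_ne_top _) ht.2)) (measure_setOf_measure_Iio_le _)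

theorem antitone_measure_Ici {α : Type*} [Preorder α] [MeasurableSpace α] (μ : Measure α) :
    Antitone fun t => μ (Set.Ici t) :=
  fun _ _ h => measure_mono (Set.Ici_subset_Ici.2 h)

/-! ### Hardy inequalities for measures on the line: sufficiency -/

section Upper

variable {ν κ ω : Measure ℝ} {V : ℝ → ℝ≥0∞} {p q : ℝ}

/-- The step that turns the local inequality `hH` into information on a level of
`G t = ν (Ici t)`: the level `k - 1` lies to the right of every point `t` of the level `k` and
carries `ν`-mass at least `2 ^ (k - 1)`, so `hH` applies to it with the value `V t`. -/
theorem zpow_le_of_mem_dyadicLevel_Ici [NullSingletonClass ν]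
    (hH : ∀ t, V t ≠ ∞ → ∀ E, MeasurableSet E → E ⊆ Set.Ici t → ν E ≤ κ E ^ (1 / p) * V t)
    {k : ℤ} {t : ℝ} (ht : t ∈ dyadicLevel (fun t => ν (Set.Ici t)) k) (hV : V t ≠ ∞) :
    2 ^ (k + 1) ≤ 4 * κ (dyadicLevel (fun t => ν (Set.Ici t)) (k - 1)) ^ (1 / p) * V t := by
  set G : ℝ → ℝ≥0∞ := fun t => ν (Set.Ici t)
  have hk : t ∈ dyadicLevel G (k - 1 + 1) := by rwa [sub_add_cancel]
  have hsub : dyadicLevel G (k - 1) ⊆ Set.Ici t := by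
    refine fun s hs => Set.mem_Ici.2 (not_lt.1 fun hst => ?_)
    have := (hk.1.trans_le (antitone_measure_Ici ν hst.le)).trans_le hs.2
    exact absurd this (lt_irrefl _)
  have h1 := (zpow_le_measure_dyadicLevel_Ici hk).trans (hH t hV _
    (measurableSet_dyadicLevel (antitone_measure_Ici ν).measurable _) hsub)
  calc (2 : ℝ≥0∞) ^ (k + 1) = 4 * 2 ^ (k - 1) := by
        have h4 : (4 : ℝ≥0∞) = 2 ^ (2 : ℤ) := by norm_num
        rw [h4, ← ENNReal.zpow_add two_ne_zero ENNReal.ofNat_ne_top]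
        congr 1; ring
    _ ≤ _ := by rw [mul_assoc]; gcongr

theorem lintegral_measure_Ici_rpow_le_tsum [NullSingletonClass ν] (hp : 0 < p) (hq : 0 < q)
    (hVω : ω {t | V t = ∞} = 0) (hκ : κ Set.univ ≠ ∞)
    (hH : ∀ t, V t ≠ ∞ → ∀ E, MeasurableSet E → E ⊆ Set.Ici t → ν E ≤ κ E ^ (1 / p) * V t) :
    ∫⁻ t, ν (Set.Ici t) ^ q ∂ω ≤ ∑' k : ℤ, (2 ^ (k + 1)) ^ q *
      ω (dyadicLevel (fun t => ν (Set.Ici t)) k ∩ {t | V t ≠ ∞}) := by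
  have hG : Measurable fun t => ν (Set.Ici t) := (antitone_measure_Ici ν).measurable
  have hae : ∀ᵐ t ∂ω, V t ≠ ∞ := by simpa [ae_iff] using hVω
  refine (lintegral_le_tsum_dyadicLevel hG (hae.mono fun t ht h0 => ⟨?_, ?_⟩)).trans
    (ENNReal.tsum_le_tsum fun k => ?_)
  · intro h; simp [h, hq] at h0
  · refine ne_top_of_le_ne_top ?_ (hH t ht _ measurableSet_Ici subset_rfl)
    refine ENNReal.mul_ne_top (ENNReal.rpow_ne_top_of_nonneg (by positivity) ?_) ht
    exact ne_top_of_le_ne_top hκ (measure_mono (Set.subset_univ _))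
  · calc ∫⁻ t in dyadicLevel (fun t => ν (Set.Ici t)) k, ν (Set.Ici t) ^ q ∂ω
        ≤ ∫⁻ _ in dyadicLevel (fun t => ν (Set.Ici t)) k, (2 ^ (k + 1)) ^ q ∂ω :=
          setLIntegral_mono' (measurableSet_dyadicLevel hG k) fun t ht =>
            ENNReal.rpow_le_rpow ht.2 hq.le
      _ = _ := by
        rw [setLIntegral_const, measure_inter_conull]
        simpa [Set.compl_ofPred] using hVω

theorem tsum_measure_dyadicLevel_sub_one_le (κ : Measure ℝ) {φ : ℝ → ℝ≥0∞} (hφ : Measurable φ) :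
    ∑' k : ℤ, κ (dyadicLevel φ (k - 1)) ≤ κ Set.univ := by
  refine ((Equiv.subRight (1 : ℤ)).tsum_eq fun k => κ (dyadicLevel φ k)).trans_le ?_
  exact tsum_meas_le_meas_iUnion_of_disjoint κ (measurableSet_dyadicLevel hφ)
    (pairwise_disjoint_dyadicLevel φ) |>.trans (measure_mono (Set.subset_univ _))

/-- The Hardy inequality for measures, `p ≤ q`. Here `ν` is the distribution of `g`, `κ` that of
`g ^ p v`, and `hH` is Hölder's inequality. Since the levels of `ν (Ici t)` are disjoint, the
estimates on the single levels add up because `q / p ≥ 1`. -/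
theorem lintegral_measure_Ici_rpow_le_of_le [NullSingletonClass ν] [NullSingletonClass ω]
    (hp : 0 < p) (hpq : p ≤ q) (hV0 : ∀ t, V t ≠ 0)
    (hH : ∀ t, V t ≠ ∞ → ∀ E, MeasurableSet E → E ⊆ Set.Ici t → ν E ≤ κ E ^ (1 / p) * V t)
    {D : ℝ≥0∞} (hDtop : D ≠ ∞) (hD : ∀ t, ω (Set.Iio t) ^ (1 / q) * V t ≤ D) :
    ∫⁻ t, ν (Set.Ici t) ^ q ∂ω ≤ (4 * D * κ Set.univ ^ (1 / p)) ^ q := by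
  have hq : 0 < q := hp.trans_le hpq
  -- `D = 0` forces `ω = 0`; it has to be split off because of `0 * ∞ = 0` on the right.
  rcases eq_or_ne D 0 with rfl | hD0
  · have hω : ω = 0 := by
      refine Measure.measure_univ_eq_zero.1 (le_antisymm ?_ zero_le)
      refine measure_le_of_forall_measure_Iio_le fun t _ => ?_
      have := hD t
      simp only [nonpos_iff_eq_zero, mul_eq_zero, hV0 t, or_false] at this ⊢
      exact (ENNReal.rpow_eq_zero_iff_of_pos (by positivity)).1 this
    simp [hω]
  rcases eq_or_ne (κ Set.univ) ∞ with hκ | hκ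
  · simp [hκ, hp, hq, hD0]
  have hVω : ω {t | V t = ∞} = 0 := by
    refine le_antisymm (measure_le_of_forall_measure_Iio_le fun t ht => ?_) zero_le
    have h := ne_top_of_le_ne_top hDtop (hD t)
    rw [ht] at h
    by_contra h0
    refine h (ENNReal.mul_top ?_)
    simpa [hq, hq.le] using h0
  set G : ℝ → ℝ≥0∞ := fun t => ν (Set.Ici t)
  have hG : Measurable G := (antitone_measure_Ici ν).measurable
  refine (lintegral_measure_Ici_rpow_le_tsum hp hq hVω hκ hH).trans ?_
  have hk (k : ℤ) : (2 ^ (k + 1)) ^ q * ω (dyadicLevel G k ∩ {t | V t ≠ ∞}) ≤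
      (4 * D) ^ q * κ (dyadicLevel G (k - 1)) ^ (q / p) := by
    have h2 : ((2 : ℝ≥0∞) ^ (k + 1)) ^ q ≠ ∞ :=
      ENNReal.rpow_ne_top_of_nonneg hq.le (ennreal_two_zpow_ne_top _)
    have h20 : ((2 : ℝ≥0∞) ^ (k + 1)) ^ q ≠ 0 := by
      simp [ennreal_two_zpow_ne_zero, ennreal_two_zpow_ne_top]
    rw [mul_comm, ← ENNReal.le_div_iff_mul_le (Or.inl h20) (Or.inl h2)]
    refine measure_le_of_forall_measure_Iio_le fun t ht => ?_
    rw [ENNReal.le_div_iff_mul_le (Or.inl h20) (Or.inl h2)]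
    calc ω (Set.Iio t) * (2 ^ (k + 1)) ^ q
        ≤ ω (Set.Iio t) * (4 * κ (dyadicLevel G (k - 1)) ^ (1 / p) * V t) ^ q := by
          gcongr
          exact zpow_le_of_mem_dyadicLevel_Ici hH ht.1 ht.2
      _ = (ω (Set.Iio t) ^ (1 / q) * V t) ^ q * 4 ^ q * κ (dyadicLevel G (k - 1)) ^ (q / p) := by
          simp only [ENNReal.mul_rpow_of_nonneg _ _ hq.le, ← ENNReal.rpow_mul]
          rw [one_div_mul_cancel hq.ne', ENNReal.rpow_one, one_div_mul_eq_div]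
          ring
      _ ≤ D ^ q * 4 ^ q * κ (dyadicLevel G (k - 1)) ^ (q / p) := by
          gcongr
          exact hD t
      _ = _ := by rw [ENNReal.mul_rpow_of_nonneg _ _ hq.le]; ring
  -- `x ^ (q / p) = x ^ (q / p - 1) * x` linearizes the sum over the levels.
  have hqp : 0 ≤ q / p - 1 := by rw [sub_nonneg, one_le_div hp]; exact hpq
  have split (x : ℝ≥0∞) : x ^ (q / p) = x ^ (q / p - 1) * x := by
    conv_rhs => rw [← ENNReal.rpow_one x, ← ENNReal.rpow_mul, one_mul]
    rw [← ENNReal.rpow_add_of_nonneg _ _ hqp zero_le_one]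
    congr 1; ring
  calc ∑' k : ℤ, (2 ^ (k + 1)) ^ q * ω (dyadicLevel G k ∩ {t | V t ≠ ∞})
      ≤ ∑' k : ℤ, (4 * D) ^ q * (κ Set.univ ^ (q / p - 1) * κ (dyadicLevel G (k - 1))) := by
        refine ENNReal.tsum_le_tsum fun k => (hk k).trans ?_
        rw [split]
        gcongr
        exact Set.subset_univ _
    _ = (4 * D) ^ q * (κ Set.univ ^ (q / p - 1) * ∑' k : ℤ, κ (dyadicLevel G (k - 1))) := by
        rw [ENNReal.tsum_mul_left, ENNReal.tsum_mul_left]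
    _ ≤ (4 * D) ^ q * (κ Set.univ ^ (q / p - 1) * κ Set.univ) := by
        gcongr
        exact tsum_measure_dyadicLevel_sub_one_le κ hG
    _ = _ := by
        rw [← split, ENNReal.mul_rpow_of_nonneg _ (κ Set.univ ^ (1 / p)) hq.le, ← ENNReal.rpow_mul,
          one_div_mul_eq_div]

theorem measure_eq_zero_of_setLIntegral_rpow_measure_Iio [NullSingletonClass ω] {s : ℝ}
    (hs : 0 ≤ s) {S : Set ℝ} (hS : ∫⁻ t in S, ω (Set.Iio t) ^ s ∂ω = 0) : ω S = 0 := by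
  have h := (rpow_half_measure_univ_le_lintegral (ω.restrict S) hs).trans
    (lintegral_mono fun t => ENNReal.rpow_le_rpow (Measure.restrict_apply_le S _) hs)
  rw [hS, nonpos_iff_eq_zero, ENNReal.rpow_eq_zero_iff_of_pos (by linarith)] at h
  simpa using h

/-- The Hardy inequality for measures, `q < p`. On each level the mass of `ω` is bounded by
`rpow_half_measure_univ_le_lintegral`; the estimates on the levels are added with Hölder's
inequality for sums, with exponents `p / q` and `r / q`. -/
theorem lintegral_measure_Ici_rpow_le_of_lt [NullSingletonClass ν] [NullSingletonClass ω]
    {r : ℝ} (hp : 0 < p) (hq : 0 < q) (hr : 0 < r) (hrpq : 1 / r = 1 / q - 1 / p)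
    (hV : Antitone V) (hV0 : ∀ t, V t ≠ 0)
    (hH : ∀ t, V t ≠ ∞ → ∀ E, MeasurableSet E → E ⊆ Set.Ici t → ν E ≤ κ E ^ (1 / p) * V t)
    {D : ℝ≥0∞} (hDtop : D ≠ ∞) (hD : ∫⁻ t, ω (Set.Iio t) ^ (r / p) * V t ^ r ∂ω ≤ D ^ r) :
    ∫⁻ t, ν (Set.Ici t) ^ q ∂ω ≤ 2 * (4 * D * κ Set.univ ^ (1 / p)) ^ q := by
  have hs : 0 ≤ r / p := by positivity
  have hΩ : Measurable fun t => ω (Set.Iio t) := (monotone_measure_Iio ω).measurable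
  have hVm : Measurable V := hV.measurable
  have hI : Measurable fun t => ω (Set.Iio t) ^ (r / p) * V t ^ r :=
    (hΩ.pow_const _).mul (hVm.pow_const _)
  have hsq : 1 + r / p = r / q := by field_simp at hrpq ⊢; linarith
  have hqr : q / p + q / r = 1 := by field_simp at hrpq ⊢; linarith
  -- `D = 0` forces `ω = 0`; it has to be split off because of `0 * ∞ = 0` on the right.
  rcases eq_or_ne D 0 with rfl | hD0
  · have hω : ω Set.univ = 0 := by
      refine measure_eq_zero_of_setLIntegral_rpow_measure_Iio hs ?_
      rw [ENNReal.zero_rpow_of_pos hr, nonpos_iff_eq_zero, lintegral_eq_zero_iff hI] at hD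
      rw [Measure.restrict_univ, lintegral_eq_zero_iff (hΩ.pow_const _)]
      filter_upwards [hD] with t ht
      simpa [hV0 t, hr, hr.le, not_lt.2] using ht
    simp [Measure.measure_univ_eq_zero.1 hω]
  rcases eq_or_ne (κ Set.univ) ∞ with hκ | hκ
  · simp [hκ, hp, hq, hD0]
  have hVω : ω {t | V t = ∞} = 0 := by
    have hm : MeasurableSet {t | V t = ∞} := hVm (measurableSet_singleton _)
    refine measure_eq_zero_of_setLIntegral_rpow_measure_Iio hs ?_
    have h1 : (∫⁻ t in {t | V t = ∞}, ω (Set.Iio t) ^ (r / p) ∂ω) * ∞ ≤ D ^ r := by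
      rw [← lintegral_mul_const _ (hΩ.pow_const _)]
      refine le_trans (le_trans (setLIntegral_mono' hm fun t ht => ?_)
        (setLIntegral_le_lintegral {t | V t = ∞} _)) hD
      rw [show V t = ∞ from ht, ENNReal.top_rpow_of_pos hr]
    by_contra h0
    rw [ENNReal.mul_top h0] at h1
    exact ENNReal.rpow_ne_top_of_nonneg hr.le hDtop (top_le_iff.1 h1)
  set G : ℝ → ℝ≥0∞ := fun t => ν (Set.Ici t)
  have hG : Measurable G := (antitone_measure_Ici ν).measurable
  refine (lintegral_measure_Ici_rpow_le_tsum hp hq hVω hκ hH).trans ?_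
  set S : ℤ → Set ℝ := fun k => dyadicLevel G k ∩ {t | V t ≠ ∞} with hSdef
  have hSm (k : ℤ) : MeasurableSet (S k) :=
    (measurableSet_dyadicLevel hG k).inter (hVm (measurableSet_singleton _)).compl
  set Q : ℤ → ℝ≥0∞ := fun k => ∫⁻ t in S k, ω (Set.Iio t) ^ (r / p) * V t ^ r ∂ω with hQ
  have hQsum : ∑' k, Q k ≤ D ^ r := by
    rw [hQ, ← lintegral_iUnion hSm]
    · exact (setLIntegral_le_lintegral _ _).trans hD
    · exact fun j k hjk => ((pairwise_disjoint_dyadicLevel G) hjk).mono Set.inter_subset_left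
        Set.inter_subset_left
  have hk (k : ℤ) : (2 ^ (k + 1)) ^ q * ω (S k) ≤
      2 * 4 ^ q * (κ (dyadicLevel G (k - 1)) ^ (q / p) * Q k ^ (q / r)) := by
    have h1 : (2 ^ (k + 1)) ^ r * (ω (S k) / 2) ^ (r / q) ≤
        4 ^ r * κ (dyadicLevel G (k - 1)) ^ (r / p) * Q k := by
      calc (2 ^ (k + 1)) ^ r * (ω (S k) / 2) ^ (r / q)
          ≤ (2 ^ (k + 1)) ^ r * ∫⁻ t in S k, ω (Set.Iio t) ^ (r / p) ∂ω := by
            gcongr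
            have h := (rpow_half_measure_univ_le_lintegral (ω.restrict (S k)) hs).trans
              (lintegral_mono fun t => ENNReal.rpow_le_rpow (Measure.restrict_apply_le (S k) _) hs)
            rwa [hsq, Measure.restrict_apply_univ] at h
        _ = ∫⁻ t in S k, (2 ^ (k + 1)) ^ r * ω (Set.Iio t) ^ (r / p) ∂ω :=
            (lintegral_const_mul _ (hΩ.pow_const _)).symm
        _ ≤ ∫⁻ t in S k, 4 ^ r * κ (dyadicLevel G (k - 1)) ^ (r / p) *
              (ω (Set.Iio t) ^ (r / p) * V t ^ r) ∂ω := by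
            refine setLIntegral_mono' (hSm k) fun t ht => ?_
            calc (2 ^ (k + 1)) ^ r * ω (Set.Iio t) ^ (r / p)
                ≤ (4 * κ (dyadicLevel G (k - 1)) ^ (1 / p) * V t) ^ r *
                    ω (Set.Iio t) ^ (r / p) := by
                  gcongr
                  exact zpow_le_of_mem_dyadicLevel_Ici hH ht.1 ht.2
              _ = _ := by
                  simp only [ENNReal.mul_rpow_of_nonneg _ _ hr.le, ← ENNReal.rpow_mul]
                  rw [one_div_mul_eq_div]
                  ring
        _ = _ := lintegral_const_mul _ hI
    have h2 := ENNReal.rpow_le_rpow h1 (show 0 ≤ q / r by positivity)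
    simp only [ENNReal.mul_rpow_of_nonneg _ _ (show 0 ≤ q / r by positivity),
      ← ENNReal.rpow_mul] at h2
    have e1 : r * (q / r) = q := by field_simp
    have e2 : r / q * (q / r) = 1 := by field_simp
    have e3 : r / p * (q / r) = q / p := by field_simp
    rw [e1, e2, e3, ENNReal.rpow_one] at h2
    calc (2 ^ (k + 1)) ^ q * ω (S k) = 2 * ((2 ^ (k + 1)) ^ q * (ω (S k) / 2)) := by
          rw [mul_left_comm, ENNReal.mul_div_cancel two_ne_zero ENNReal.ofNat_ne_top]
      _ ≤ 2 * (4 ^ q * κ (dyadicLevel G (k - 1)) ^ (q / p) * Q k ^ (q / r)) := by gcongr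
      _ = _ := by ring
  calc ∑' k : ℤ, (2 ^ (k + 1)) ^ q * ω (S k)
      ≤ ∑' k : ℤ, 2 * 4 ^ q * (κ (dyadicLevel G (k - 1)) ^ (q / p) * Q k ^ (q / r)) :=
        ENNReal.tsum_le_tsum hk
    _ = 2 * 4 ^ q * ∑' k : ℤ, κ (dyadicLevel G (k - 1)) ^ (q / p) * Q k ^ (q / r) :=
        ENNReal.tsum_mul_left
    _ ≤ 2 * 4 ^ q * ((∑' k : ℤ, κ (dyadicLevel G (k - 1))) ^ (q / p) * (∑' k, Q k) ^ (q / r)) := by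
        gcongr
        have := ENNReal.lintegral_mul_norm_pow_le (μ := Measure.count)
          (f := fun k : ℤ => κ (dyadicLevel G (k - 1))) (g := Q)
          (Measurable.of_discrete.aemeasurable)
          (Measurable.of_discrete.aemeasurable)
          (show 0 ≤ q / p by positivity) (show 0 ≤ q / r by positivity) hqr
        simpa only [lintegral_count] using this
    _ ≤ 2 * 4 ^ q * (κ Set.univ ^ (q / p) * (D ^ r) ^ (q / r)) := by
        gcongr
        exact tsum_measure_dyadicLevel_sub_one_le κ hG
    _ = _ := by
        simp only [ENNReal.mul_rpow_of_nonneg _ _ hq.le, ← ENNReal.rpow_mul]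
        rw [one_div_mul_eq_div, mul_div_cancel₀ _ hr.ne']
        ring

end Upper

/-! ### The dual weight -/

section Duality

variable {X : Type*} [MeasureSpace X] {p : ℝ≥0∞} {w : X → ℝ≥0∞} {Y : Set X}

/-- The quantity `‖w ^ (-1 / p)‖_{p', Y}` with the conjugate exponent `p'`; for `p = 1` it is the
essential supremum of `1 / w` on `Y`. It is the norm of `g ↦ ∫_Y g` on the space with norm
`(∫ g ^ p w) ^ (1 / p)`. -/
noncomputable def dualNorm (p : ℝ≥0∞) (w : X → ℝ≥0∞) (Y : Set X) : ℝ≥0∞ :=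
  weightedNorm p.conjExponent (fun _ => 1) Y fun x => w x ^ (-(1 / p.toReal))

theorem dualNorm_one (w : X → ℝ≥0∞) (Y : Set X) :
    dualNorm 1 w Y = essSup (fun x => (w x)⁻¹) (volume.restrict Y) := by
  simp [dualNorm, weightedNorm, ENNReal.conjExponent, ENNReal.rpow_neg_one]

theorem conjExponent_ne_top (hp : 1 < p) : p.conjExponent ≠ ∞ := by
  simp [ENNReal.conjExponent, tsub_eq_zero_iff_le, not_le.2 hp]

theorem holderConjugate_toReal_conjExponent (hp : 1 < p) (hp' : p ≠ ∞) :
    p.toReal.HolderConjugate p.conjExponent.toReal :=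
  have := ENNReal.HolderConjugate.conjExponent hp.le
  ENNReal.HolderConjugate.toReal_of_ne_top hp' (conjExponent_ne_top hp)

theorem dualNorm_of_one_lt (hp : 1 < p) (w : X → ℝ≥0∞) (Y : Set X) :
    dualNorm p w Y = (∫⁻ x in Y, (w x ^ (-(1 / p.toReal))) ^ p.conjExponent.toReal) ^
      (1 / p.conjExponent.toReal) := by
  simp [dualNorm, weightedNorm, conjExponent_ne_top hp]

theorem dualNorm_mono (p : ℝ≥0∞) (w : X → ℝ≥0∞) {Z : Set X} (h : Y ⊆ Z) :
    dualNorm p w Y ≤ dualNorm p w Z := by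
  unfold dualNorm weightedNorm
  split_ifs
  · exact essSup_mono_measure' (Measure.restrict_mono_set _ h)
  · gcongr

theorem dualNorm_ne_zero (hp : 1 ≤ p) (hp' : p ≠ ∞) (hw : AEMeasurable w) (hw' : ∀ x, w x ≠ ∞)
    (hY : volume Y ≠ 0) : dualNorm p w Y ≠ 0 := by
  intro h
  have hne : (ae (volume.restrict Y)).NeBot := by
    rwa [ae_neBot, Ne, Measure.restrict_eq_zero]
  rcases hp.eq_or_lt with rfl | hp1
  · rw [dualNorm_one, ENNReal.essSup_eq_zero_iff] at h
    obtain ⟨x, hx⟩ := h.exists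
    exact hw' x (ENNReal.inv_eq_zero.1 hx)
  · have hc := holderConjugate_toReal_conjExponent hp1 hp'
    have hpos := hc.symm.pos
    have hpos' := hc.pos
    rw [dualNorm_of_one_lt hp1, ENNReal.rpow_eq_zero_iff_of_pos (by positivity),
      lintegral_eq_zero_iff' (by fun_prop)] at h
    obtain ⟨x, hx⟩ := h.exists
    rw [Pi.zero_apply, ENNReal.rpow_eq_zero_iff_of_pos hpos, ENNReal.rpow_neg,
      ENNReal.inv_eq_zero] at hx
    exact ENNReal.rpow_ne_top_of_nonneg (by positivity) (hw' x) hx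

/-- Hölder's inequality. Without `hY` it fails in `ℝ≥0∞`: where `w = 0`, a function `g` may have
positive integral over `Y` although `∫ g ^ p w = 0`, and `0 * ∞ = 0`. -/
theorem setLIntegral_le_mul_dualNorm (hp : 1 ≤ p) (hp' : p ≠ ∞) (hw : AEMeasurable w)
    (hw' : ∀ x, w x ≠ ∞) {g : X → ℝ≥0∞} (hg : AEMeasurable g) (hY : dualNorm p w Y ≠ ∞) :
    ∫⁻ x in Y, g x ≤ (∫⁻ x in Y, g x ^ p.toReal * w x) ^ (1 / p.toReal) * dualNorm p w Y := by
  rcases hp.eq_or_lt with rfl | hp1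
  · simp only [ENNReal.toReal_one, ENNReal.rpow_one, div_one]
    rw [← lintegral_mul_const'' _ (by fun_prop)]
    have h : ∀ᵐ x ∂volume.restrict Y, (w x)⁻¹ ≤ dualNorm 1 w Y := by
      rw [dualNorm_one]; exact ENNReal.ae_le_essSup _
    refine lintegral_mono_ae (h.mono fun x hx => ?_)
    have h0 : w x ≠ 0 := by
      intro h0
      rw [h0, ENNReal.inv_zero, top_le_iff] at hx
      exact hY hx
    calc g x = g x * w x * (w x)⁻¹ := by
          rw [mul_assoc, ENNReal.mul_inv_cancel h0 (hw' x), mul_one]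
      _ ≤ _ := by gcongr
  · have hc := holderConjugate_toReal_conjExponent hp1 hp'
    have hpos := hc.symm.pos
    have hpos' := hc.pos
    rw [dualNorm_of_one_lt hp1] at hY ⊢
    have hfin : ∀ᵐ x ∂volume.restrict Y,
        (w x ^ (-(1 / p.toReal))) ^ p.conjExponent.toReal < ∞ := by
      refine ae_lt_top' (by fun_prop) fun h => hY ?_
      rw [h]; exact ENNReal.top_rpow_of_pos (by positivity)
    calc ∫⁻ x in Y, g x
        = ∫⁻ x in Y, ((fun x => g x * w x ^ (1 / p.toReal)) *
            fun x => w x ^ (-(1 / p.toReal))) x := by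
          refine lintegral_congr_ae (hfin.mono fun x hx => ?_)
          have h0 : w x ≠ 0 := by
            intro h0
            rw [h0, ENNReal.zero_rpow_of_neg (by simpa using hpos'),
              ENNReal.top_rpow_of_pos hpos] at hx
            exact lt_irrefl _ hx
          simp only [Pi.mul_apply]
          rw [mul_assoc, ← ENNReal.rpow_add _ _ h0 (hw' x), add_neg_cancel, ENNReal.rpow_zero,
            mul_one]
      _ ≤ (∫⁻ x in Y, (g x * w x ^ (1 / p.toReal)) ^ p.toReal) ^ (1 / p.toReal) *
            (∫⁻ x in Y, (w x ^ (-(1 / p.toReal))) ^ p.conjExponent.toReal) ^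
              (1 / p.conjExponent.toReal) :=
          ENNReal.lintegral_mul_le_Lp_mul_Lq _ hc (by fun_prop) (by fun_prop)
      _ = _ := by
          simp only [ENNReal.mul_rpow_of_nonneg _ _ hpos'.le, ← ENNReal.rpow_mul,
            one_div_mul_cancel hpos'.ne', ENNReal.rpow_one]

/-- The constant in `setLIntegral_le_mul_dualNorm` is the best one. For `p > 1` the function `h`
is a multiple of a simple function of finite integral below `w ^ (-p' / p)` on `Y`, for `p = 1` of
the indicator of a set of finite measure on which `c < 1 / w`. -/
theorem exists_le_setLIntegral_of_lt_dualNorm [SigmaFinite (volume : Measure X)] (hp : 1 ≤ p)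
    (hp' : p ≠ ∞) (hw : AEMeasurable w) (hY : MeasurableSet Y)
    {c : ℝ≥0∞} (hc : c < dualNorm p w Y) :
    ∃ h : X → ℝ≥0∞, Measurable h ∧ c ≤ ∫⁻ x in Y, h x ∧ ∫⁻ x, h x ^ p.toReal * w x ≤ 1 := by
  rcases hp.eq_or_lt with rfl | hp1
  · rcases eq_or_ne c 0 with rfl | hc0
    · exact ⟨0, measurable_zero, zero_le, by simp⟩
    rw [dualNorm_one] at hc
    have h1 : volume.restrict Y {x | c < (w x)⁻¹} ≠ 0 := by
      intro h0
      refine absurd (essSup_le_of_ae_le c ?_) (not_le.2 hc)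
      simpa [Filter.EventuallyLE, ae_iff] using h0
    have hm : NullMeasurableSet {x | c < (w x)⁻¹} (volume.restrict Y) :=
      nullMeasurableSet_lt aemeasurable_const hw.inv.restrict
    obtain ⟨E₀, hE₀s, hE₀m, hE₀⟩ := hm.exists_measurable_subset_ae_eq
    rw [← measure_congr hE₀, Measure.restrict_apply hE₀m] at h1
    obtain ⟨E, hEm, hEs, hE0, hEtop⟩ :=
      Measure.exists_subset_measure_lt_top (hE₀m.inter hY) (pos_iff_ne_zero.2 h1)
    have hcE (x) (hx : x ∈ E) : c * w x ≤ 1 := by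
      have : c < (w x)⁻¹ := hE₀s (hEs hx).1
      calc c * w x ≤ (w x)⁻¹ * w x := by gcongr
        _ ≤ 1 := ENNReal.inv_mul_le_one _
    refine ⟨E.indicator fun _ => c * (volume E)⁻¹, measurable_const.indicator hEm, ?_, ?_⟩
    · rw [lintegral_indicator hEm, setLIntegral_const, Measure.restrict_apply hEm,
        Set.inter_eq_left.2 fun x hx => (hEs hx).2, mul_assoc,
        ENNReal.inv_mul_cancel hE0.ne' hEtop.ne, mul_one]
    · calc ∫⁻ x, (E.indicator (fun _ => c * (volume E)⁻¹) x) ^ (1 : ℝ≥0∞).toReal * w x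
          ≤ ∫⁻ x, E.indicator (fun _ => (volume E)⁻¹) x := by
            refine lintegral_mono fun x => ?_
            by_cases hx : x ∈ E
            · simp only [ENNReal.toReal_one, ENNReal.rpow_one, Set.indicator_of_mem hx]
              calc c * (volume E)⁻¹ * w x = c * w x * (volume E)⁻¹ := by ring
                _ ≤ 1 * (volume E)⁻¹ := by gcongr; exact hcE x hx
                _ = _ := one_mul _
            · simp [Set.indicator_of_notMem hx]
        _ ≤ 1 := by
            rw [lintegral_indicator hEm, setLIntegral_const]
            exact ENNReal.inv_mul_le_one _
  · have hconj := holderConjugate_toReal_conjExponent hp1 hp'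
    have hpos := hconj.symm.pos
    have hpos' := hconj.pos
    set P := p.toReal
    set P' := p.conjExponent.toReal
    rw [dualNorm_of_one_lt hp1, one_div P', ENNReal.lt_rpow_inv_iff hpos,
      lintegral_eq_nnreal] at hc
    simp only [lt_iSup_iff] at hc
    obtain ⟨φ₀, hφ₀, hcφ₀⟩ := hc
    rw [← SimpleFunc.lintegral_eq_lintegral] at hcφ₀
    obtain ⟨φ, hφ, hφtop, hcφ⟩ := SimpleFunc.exists_lt_lintegral_simpleFunc_of_lt_lintegral hcφ₀
    set I := ∫⁻ x in Y, φ x with hI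
    have hI0 : I ≠ 0 := hcφ.ne_bot
    have hIinv0 : I ^ (-(1 / P)) ≠ ∞ := by
      rw [ENNReal.rpow_neg]
      simp [hI0, hpos', hpos'.le]
    have hφm : Measurable fun x => (φ x : ℝ≥0∞) := φ.measurable.coe_nnreal_ennreal
    refine ⟨Y.indicator fun x => φ x * I ^ (-(1 / P)), (hφm.mul_const _).indicator hY, ?_, ?_⟩
    · rw [lintegral_indicator hY, Measure.restrict_restrict hY, Set.inter_self,
        lintegral_mul_const _ hφm, ← hI]
      calc c ≤ I ^ (1 / P') := by
            rw [one_div, ENNReal.le_rpow_inv_iff hpos]; exact hcφ.le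
        _ = I ^ (1 + -(1 / P)) := by
            congr 1
            have := hconj.inv_add_inv_eq_one
            rw [one_div, one_div]; linarith
        _ = I * I ^ (-(1 / P)) := by
            rw [ENNReal.rpow_add _ _ hI0 hφtop.ne, ENNReal.rpow_one]
    · have hpt (x : X) : (φ x : ℝ≥0∞) ^ P * w x ≤ φ x := by
        have h1 : (φ x : ℝ≥0∞) ≤ (w x ^ (-(1 / P))) ^ P' :=
          (ENNReal.coe_le_coe.2 (hφ x)).trans (hφ₀ x)
        have h2 := hconj.sub_one_pos
        have h3 : (φ x : ℝ≥0∞) ^ (P - 1) ≤ (w x)⁻¹ := by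
          refine (ENNReal.rpow_le_rpow h1 h2.le).trans_eq ?_
          rw [← ENNReal.rpow_mul, ← ENNReal.rpow_mul, ← ENNReal.rpow_neg_one]
          congr 1
          have := hconj.sub_one_mul_conj
          calc -(1 / P) * (P' * (P - 1)) = -(1 / P) * ((P - 1) * P') := by ring
            _ = -1 := by rw [this]; field_simp
        calc (φ x : ℝ≥0∞) ^ P * w x = φ x * (φ x : ℝ≥0∞) ^ (P - 1) * w x := by
              congr 1
              conv_rhs => rw [← ENNReal.rpow_one (φ x : ℝ≥0∞), ← ENNReal.rpow_mul, one_mul]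
              rw [← ENNReal.rpow_add_of_nonneg _ _ zero_le_one h2.le]
              congr 1; ring
          _ ≤ φ x * (w x)⁻¹ * w x := by gcongr
          _ ≤ φ x := by
              rw [mul_assoc]
              exact mul_le_of_le_one_right' (ENNReal.inv_mul_le_one _)
      calc ∫⁻ x, (Y.indicator (fun x => φ x * I ^ (-(1 / P))) x) ^ P * w x
          ≤ ∫⁻ x, Y.indicator (fun x => φ x * I⁻¹) x := by
            refine lintegral_mono fun x => ?_
            by_cases hx : x ∈ Y
            · simp only [Set.indicator_of_mem hx]
              rw [ENNReal.mul_rpow_of_nonneg _ _ hpos'.le, ← ENNReal.rpow_mul, neg_mul,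
                one_div_mul_cancel hpos'.ne', ENNReal.rpow_neg_one, mul_right_comm]
              gcongr
              exact hpt x
            · simp [Set.indicator_of_notMem hx, hpos']
        _ ≤ 1 := by
            rw [lintegral_indicator hY, lintegral_mul_const _ hφm]
            exact ENNReal.mul_inv_le_one _

end Duality

/-! ### Hardy inequalities: necessity -/

section Lower

variable {X : Type*} [MeasureSpace X] [SigmaFinite (volume : Measure X)] {p : ℝ≥0∞}
  {w : X → ℝ≥0∞} {ρ : X → ℝ} {ω : Measure ℝ} {q : ℝ} {C : ℝ≥0∞}

/-- Test the inequality with almost extremal functions for `dualNorm` on `{t ≤ ρ}`. This holds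
whatever the order of `p` and `q` is. -/
theorem rpow_measure_Iio_mul_dualNorm_le (hp : 1 ≤ p) (hp' : p ≠ ∞) (hq : 0 < q)
    (hw : AEMeasurable w) (hρ : Measurable ρ)
    (hI : ∀ g : X → ℝ≥0∞, Measurable g → ∫⁻ t, (∫⁻ x in ρ ⁻¹' Set.Ici t, g x) ^ q ∂ω ≤
      (C * (∫⁻ x, g x ^ p.toReal * w x) ^ (1 / p.toReal)) ^ q) (t : ℝ) :
    ω (Set.Iio t) ^ (1 / q) * dualNorm p w (ρ ⁻¹' Set.Ici t) ≤ C := by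
  refine ENNReal.mul_le_of_forall_lt fun a ha c hc => ?_
  have hY : MeasurableSet (ρ ⁻¹' Set.Ici t) := hρ measurableSet_Ici
  obtain ⟨h, hhm, hch, hh1⟩ := exists_le_setLIntegral_of_lt_dualNorm hp hp' hw hY hc
  refine (mul_le_mul_left ha.le c).trans ?_
  rw [← ENNReal.rpow_le_rpow_iff hq, ENNReal.mul_rpow_of_nonneg _ _ hq.le, ← ENNReal.rpow_mul,
    one_div_mul_cancel hq.ne', ENNReal.rpow_one, mul_comm]
  calc c ^ q * ω (Set.Iio t) = ∫⁻ _ in Set.Iio t, c ^ q ∂ω := (setLIntegral_const _ _).symm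
    _ ≤ ∫⁻ s in Set.Iio t, (∫⁻ x in ρ ⁻¹' Set.Ici s, h x) ^ q ∂ω := by
        refine setLIntegral_mono' measurableSet_Iio fun s hs => ?_
        gcongr
        refine hch.trans (lintegral_mono_set (Set.preimage_mono (Set.Ici_subset_Ici.2 ?_)))
        exact le_of_lt hs
    _ ≤ ∫⁻ s, (∫⁻ x in ρ ⁻¹' Set.Ici s, h x) ^ q ∂ω := setLIntegral_le_lintegral _ _
    _ ≤ (C * (∫⁻ x, h x ^ p.toReal * w x) ^ (1 / p.toReal)) ^ q := hI h hhm
    _ ≤ C ^ q := by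
        gcongr
        exact mul_le_of_le_one_right' (ENNReal.rpow_le_one hh1 (by positivity))

theorem tsum_setLIntegral_dyadicLevel_sub_one_le (ω : Measure ℝ) {φ : ℝ → ℝ≥0∞}
    (hφ : Measurable φ) (ψ : ℝ → ℝ≥0∞) :
    ∑' k : ℤ, ∫⁻ t in dyadicLevel φ (k - 1), ψ t ∂ω ≤ ∫⁻ t, ψ t ∂ω := by
  refine ((Equiv.subRight (1 : ℤ)).tsum_eq fun k => ∫⁻ t in dyadicLevel φ k, ψ t ∂ω).trans_le ?_
  rw [← lintegral_iUnion (measurableSet_dyadicLevel hφ) (pairwise_disjoint_dyadicLevel φ)]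
  exact setLIntegral_le_lintegral _ _

/-- Necessity for `q < p`. Let `Ω t = ω (Iio t)` and let `Z k` be the set where `2 ^ k < Ω ∘ ρ`.
The test function is the `ℓ ^ p` combination `(∑ b_k h_k ^ p) ^ (1 / p)` of almost extremal
functions `h_k` for `dualNorm` on `Z k`. Its `p`-norm is at most `(∑ b_k) ^ (1 / p)` although the
`Z k` are not disjoint, and it dominates `b_k ^ (1 / p) h_k`, whose integral over `{t ≤ ρ} ⊇ Z k`
is used for `t` in the level `k - 1` of `Ω`. -/
theorem lintegral_rpow_measure_Iio_mul_dualNorm_le [NullSingletonClass ω] {r : ℝ}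
    (hp : 1 ≤ p) (hp' : p ≠ ∞) (hq : 0 < q) (hr : 0 < r)
    (hrpq : 1 / r = 1 / q - 1 / p.toReal) (hw : AEMeasurable w) (hρ : Measurable ρ)
    (hV0 : ∀ t, dualNorm p w (ρ ⁻¹' Set.Ici t) ≠ 0) (hC : C ≠ ∞)
    (hI : ∀ g : X → ℝ≥0∞, Measurable g → ∫⁻ t, (∫⁻ x in ρ ⁻¹' Set.Ici t, g x) ^ q ∂ω ≤
      (C * (∫⁻ x, g x ^ p.toReal * w x) ^ (1 / p.toReal)) ^ q) :
    ∫⁻ t, ω (Set.Iio t) ^ (r / p.toReal) * dualNorm p w (ρ ⁻¹' Set.Ici t) ^ r ∂ω ≤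
      (2 ^ (q + 2) * C ^ q) ^ (r / q) := by
  classical
  have hP : 0 < p.toReal := ENNReal.toReal_pos (zero_lt_one.trans_le hp).ne' hp'
  set P := p.toReal
  have hsq : 1 + r / P = r / q := by field_simp at hrpq ⊢; linarith
  have hqr : q / P + q / r = 1 := by field_simp at hrpq ⊢; linarith
  set V : ℝ → ℝ≥0∞ := fun t => dualNorm p w (ρ ⁻¹' Set.Ici t) with hVdef
  set Ω : ℝ → ℝ≥0∞ := fun t => ω (Set.Iio t) with hΩdef
  have hΩ : Measurable Ω := (monotone_measure_Iio ω).measurable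
  have hΩV (t : ℝ) : Ω t ^ (1 / q) * V t ≤ C :=
    rpow_measure_Iio_mul_dualNorm_le hp hp' hq hw hρ hI t
  have hΩtop (t : ℝ) : Ω t ≠ ∞ := by
    intro h
    have := hΩV t
    rw [h, ENNReal.top_rpow_of_pos (by positivity), ENNReal.top_mul (hV0 t)] at this
    exact hC (top_le_iff.1 this)
  set Z : ℤ → Set X := fun k => ρ ⁻¹' {s | 2 ^ k < Ω s} with hZ
  have hZm (k : ℤ) : MeasurableSet (Z k) := hρ (hΩ measurableSet_Ioi)
  have hVZ {k : ℤ} {t : ℝ} (ht : t ∈ dyadicLevel Ω k) : V t ≤ dualNorm p w (Z k) :=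
    dualNorm_mono _ _ fun x hx => ht.1.trans_le (monotone_measure_Iio ω hx)
  have hZT {k : ℤ} {t : ℝ} (ht : t ∈ dyadicLevel Ω (k - 1)) : Z k ⊆ ρ ⁻¹' Set.Ici t := by
    intro x hx
    refine Set.mem_Ici.2 (not_lt.1 fun hlt : ρ x < t => ?_)
    have h1 : Ω (ρ x) ≤ Ω t := monotone_measure_Iio ω hlt.le
    have h2 := ht.2
    rw [sub_add_cancel] at h2
    exact absurd (h1.trans h2) (not_le.2 hx)
  have hωk {k : ℤ} (hk : (dyadicLevel Ω k).Nonempty) :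
      2 ^ (k - 1) ≤ ω (dyadicLevel Ω (k - 1)) := by
    obtain ⟨t, ht⟩ := hk
    exact zpow_le_measure_dyadicLevel_Iio (t := t) (by rwa [sub_add_cancel])
  -- The equality case of Hölder's inequality for sums: `b_k ^ (q / r) = 2 ^ k ‖·‖_{Z k} ^ q`.
  set b : ℤ → ℝ≥0∞ := fun k =>
    if (dyadicLevel Ω k).Nonempty then (2 ^ k) ^ (r / q) * dualNorm p w (Z k) ^ r else 0 with hb
  have hZtop {k : ℤ} (hk : (dyadicLevel Ω k).Nonempty) : dualNorm p w (Z k) ≠ ∞ := by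
    have hne : (dyadicLevel Ω (k - 1)).Nonempty := by
      refine nonempty_of_measure_ne_zero (μ := ω) fun h0 => ennreal_two_zpow_ne_zero (k - 1) ?_
      simpa [h0] using hωk hk
    obtain ⟨t, ht⟩ := hne
    refine ne_top_of_le_ne_top (fun h => ?_) (dualNorm_mono p w (hZT ht))
    have h1 := hΩV t
    rw [show V t = ∞ from h, ENNReal.mul_top] at h1
    · exact hC (top_le_iff.1 h1)
    · have := ht.1.ne_bot
      simp only [bot_eq_zero] at this
      simp [this, hq, hq.le]
  have hbtop (k : ℤ) : b k ≠ ∞ := by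
    simp only [hb]
    split_ifs with hk
    · exact ENNReal.mul_ne_top (ENNReal.rpow_ne_top_of_nonneg (by positivity)
        (ennreal_two_zpow_ne_top k)) (ENNReal.rpow_ne_top_of_nonneg hr.le (hZtop hk))
    · exact ENNReal.zero_ne_top
  have hex (k : ℤ) : ∃ h : X → ℝ≥0∞, Measurable h ∧ ((dyadicLevel Ω k).Nonempty →
      dualNorm p w (Z k) / 2 ≤ ∫⁻ x in Z k, h x) ∧ ∫⁻ x, h x ^ P * w x ≤ 1 := by
    by_cases hk : (dyadicLevel Ω k).Nonempty
    · have h0 : dualNorm p w (Z k) ≠ 0 := by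
        obtain ⟨t, ht⟩ := hk
        exact fun h => hV0 t (le_antisymm ((hVZ ht).trans_eq h) zero_le)
      obtain ⟨h, h1, h2, h3⟩ := exists_le_setLIntegral_of_lt_dualNorm hp hp' hw (hZm k)
        (ENNReal.half_lt_self h0 (hZtop hk))
      exact ⟨h, h1, fun _ => h2, h3⟩
    · exact ⟨0, measurable_zero, fun h => absurd h hk, by simp [hP]⟩
  choose h hhm hhV hh1 using hex
  -- Finite sums only, so that a power of the sum may be cancelled.
  have hfin (F : Finset ℤ) : ∑ k ∈ F, b k ≤ (2 ^ (q + 1) * C ^ q) ^ (r / q) := by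
    set B := ∑ k ∈ F, b k with hB
    have hBtop : B ≠ ∞ := ENNReal.sum_ne_top.2 fun k _ => hbtop k
    set g : X → ℝ≥0∞ := fun x => (∑ k ∈ F, b k * h k x ^ P) ^ (1 / P) with hg
    have hgm : Measurable g := by
      refine Measurable.pow_const (Finset.measurable_fun_sum _ fun k _ => ?_) _
      exact ((hhm k).pow_const _).const_mul _
    have hgle {k : ℤ} (hk : k ∈ F) (x : X) : b k ^ (1 / P) * h k x ≤ g x := by
      calc b k ^ (1 / P) * h k x = (b k * h k x ^ P) ^ (1 / P) := by
            rw [ENNReal.mul_rpow_of_nonneg _ _ (by positivity), ← ENNReal.rpow_mul (h k x),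
              mul_one_div_cancel hP.ne', ENNReal.rpow_one]
        _ ≤ g x := by
            refine ENNReal.rpow_le_rpow ?_ (by positivity)
            exact Finset.single_le_sum (f := fun k => b k * h k x ^ P) (fun _ _ => zero_le) hk
    have hgB : ∫⁻ x, g x ^ P * w x ≤ B := by
      calc ∫⁻ x, g x ^ P * w x = ∫⁻ x, ∑ k ∈ F, b k * (h k x ^ P * w x) := by
            refine lintegral_congr fun x => ?_
            simp only [hg]
            rw [← ENNReal.rpow_mul, one_div_mul_cancel hP.ne', ENNReal.rpow_one, Finset.sum_mul]
            simp only [mul_assoc]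
        _ = ∑ k ∈ F, b k * ∫⁻ x, h k x ^ P * w x := by
            have hm (k : ℤ) : AEMeasurable fun x => h k x ^ P * w x :=
              ((hhm k).pow_const _).aemeasurable.mul hw
            rw [lintegral_finsetSum' _ fun k _ => (hm k).const_mul _]
            exact Finset.sum_congr rfl fun k _ => lintegral_const_mul'' _ (hm k)
        _ ≤ B := Finset.sum_le_sum fun k _ => mul_le_of_le_one_right' (hh1 k)
    have hstep (k : ℤ) (hk : k ∈ F) : b k ≤ 2 ^ (q + 1) *
        ∫⁻ t in dyadicLevel Ω (k - 1), (∫⁻ x in ρ ⁻¹' Set.Ici t, g x) ^ q ∂ω := by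
      by_cases hne : (dyadicLevel Ω k).Nonempty
      · have hbk : b k = (2 ^ k) ^ (r / q) * dualNorm p w (Z k) ^ r := by simp [hb, hne]
        have hbqr : b k ^ (q / r) = 2 ^ k * dualNorm p w (Z k) ^ q := by
          rw [hbk, ENNReal.mul_rpow_of_nonneg _ _ (by positivity), ← ENNReal.rpow_mul,
            ← ENNReal.rpow_mul, show r / q * (q / r) = 1 by field_simp, ENNReal.rpow_one,
            show r * (q / r) = q by field_simp]
        have hbsplit : b k = b k ^ (q / P) * b k ^ (q / r) := by
          rw [← ENNReal.rpow_add_of_nonneg _ _ (by positivity) (by positivity), hqr,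
            ENNReal.rpow_one]
        have h2k : (2 : ℝ≥0∞) ^ k = 2 * 2 ^ (k - 1) := by
          conv_lhs => rw [← sub_add_cancel k 1, ennreal_two_zpow_add_one, ← two_mul]
        have hV2 : dualNorm p w (Z k) = 2 * (dualNorm p w (Z k) / 2) :=
          (ENNReal.mul_div_cancel two_ne_zero ENNReal.ofNat_ne_top).symm
        calc b k = 2 ^ (q + 1) *
              ((b k ^ (1 / P) * (dualNorm p w (Z k) / 2)) ^ q * 2 ^ (k - 1)) := by
              conv_lhs => rw [hbsplit, hbqr, h2k, hV2]
              rw [ENNReal.mul_rpow_of_nonneg _ _ hq.le, ENNReal.mul_rpow_of_nonneg _ _ hq.le,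
                ← ENNReal.rpow_mul, one_div_mul_eq_div,
                ENNReal.rpow_add_of_nonneg _ _ hq.le zero_le_one, ENNReal.rpow_one]
              ring
          _ ≤ 2 ^ (q + 1) * ((∫⁻ x in Z k, g x) ^ q * ω (dyadicLevel Ω (k - 1))) := by
              gcongr
              · calc b k ^ (1 / P) * (dualNorm p w (Z k) / 2)
                    ≤ b k ^ (1 / P) * ∫⁻ x in Z k, h k x := by gcongr; exact hhV k hne
                  _ = ∫⁻ x in Z k, b k ^ (1 / P) * h k x := (lintegral_const_mul _ (hhm k)).symm
                  _ ≤ ∫⁻ x in Z k, g x := lintegral_mono (hgle hk)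
              · exact hωk hne
          _ = 2 ^ (q + 1) * ∫⁻ _ in dyadicLevel Ω (k - 1), (∫⁻ x in Z k, g x) ^ q ∂ω := by
              rw [setLIntegral_const]
          _ ≤ _ := by
              gcongr 1
              refine setLIntegral_mono' (measurableSet_dyadicLevel hΩ _) fun t ht => ?_
              exact ENNReal.rpow_le_rpow (lintegral_mono_set (hZT ht)) hq.le
      · simp [hb, hne]
    have hBle : B ≤ 2 ^ (q + 1) * C ^ q * B ^ (q / P) := by
      calc B ≤ ∑ k ∈ F, 2 ^ (q + 1) *
            ∫⁻ t in dyadicLevel Ω (k - 1), (∫⁻ x in ρ ⁻¹' Set.Ici t, g x) ^ q ∂ω :=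
            Finset.sum_le_sum hstep
        _ ≤ 2 ^ (q + 1) * ∫⁻ t, (∫⁻ x in ρ ⁻¹' Set.Ici t, g x) ^ q ∂ω := by
            rw [← Finset.mul_sum]
            gcongr
            exact (ENNReal.sum_le_tsum F).trans (tsum_setLIntegral_dyadicLevel_sub_one_le ω hΩ _)
        _ ≤ 2 ^ (q + 1) * (C * B ^ (1 / P)) ^ q := by
            gcongr
            refine (hI g hgm).trans ?_
            gcongr
        _ = _ := by
            rw [ENNReal.mul_rpow_of_nonneg _ _ hq.le, ← ENNReal.rpow_mul, one_div_mul_eq_div,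
              mul_assoc]
    rcases eq_or_ne B 0 with hB0 | hB0
    · simp [hB0]
    have hBP0 : B ^ (q / P) ≠ 0 := by simp [hB0, hBtop]
    have hBPtop : B ^ (q / P) ≠ ∞ := ENNReal.rpow_ne_top_of_nonneg (by positivity) hBtop
    have hBqr : B ^ (q / r) ≤ 2 ^ (q + 1) * C ^ q := by
      refine (ENNReal.mul_le_mul_iff_left hBP0 hBPtop).1 ?_
      rwa [← ENNReal.rpow_add_of_nonneg _ _ (by positivity) (by positivity), add_comm, hqr,
        ENNReal.rpow_one]
    calc B = (B ^ (q / r)) ^ (r / q) := by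
          rw [← ENNReal.rpow_mul, show q / r * (r / q) = 1 by field_simp, ENNReal.rpow_one]
      _ ≤ _ := by gcongr
  have hlev (k : ℤ) : ∫⁻ t in dyadicLevel Ω k, Ω t ^ (r / P) * V t ^ r ∂ω ≤
      2 ^ (r / q) * b k := by
    by_cases hne : (dyadicLevel Ω k).Nonempty
    · calc ∫⁻ t in dyadicLevel Ω k, Ω t ^ (r / P) * V t ^ r ∂ω
          ≤ ∫⁻ _ in dyadicLevel Ω k, (2 ^ (k + 1)) ^ (r / P) * dualNorm p w (Z k) ^ r ∂ω := by
            refine setLIntegral_mono' (measurableSet_dyadicLevel hΩ k) fun t ht => ?_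
            gcongr
            · exact ht.2
            · exact hVZ ht
        _ ≤ (2 ^ (k + 1)) ^ (r / P) * dualNorm p w (Z k) ^ r * 2 ^ (k + 1) := by
            rw [setLIntegral_const]
            gcongr
            exact (measure_mono fun t ht => ht.2).trans (measure_setOf_measure_Iio_le _)
        _ = (2 * 2 ^ k) ^ (r / q) * dualNorm p w (Z k) ^ r := by
            rw [ennreal_two_zpow_add_one, ← two_mul, ← hsq,
              ENNReal.rpow_add_of_nonneg _ _ zero_le_one (by positivity), ENNReal.rpow_one]
            ring
        _ = 2 ^ (r / q) * b k := by
            rw [ENNReal.mul_rpow_of_nonneg _ _ (by positivity)]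
            simp [hb, hne, mul_assoc]
    · simp [Set.not_nonempty_iff_eq_empty.1 hne]
  calc ∫⁻ t, Ω t ^ (r / P) * V t ^ r ∂ω
      ≤ ∑' k, ∫⁻ t in dyadicLevel Ω k, Ω t ^ (r / P) * V t ^ r ∂ω := by
        refine lintegral_le_tsum_dyadicLevel hΩ (Filter.Eventually.of_forall fun t ht => ?_)
        refine ⟨fun h0 => ht ?_, hΩtop t⟩
        rw [h0, ENNReal.zero_rpow_of_pos (by positivity), zero_mul]
    _ ≤ ∑' k, 2 ^ (r / q) * b k := ENNReal.tsum_le_tsum hlev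
    _ = 2 ^ (r / q) * ∑' k, b k := ENNReal.tsum_mul_left
    _ ≤ 2 ^ (r / q) * (2 ^ (q + 1) * C ^ q) ^ (r / q) := by
        gcongr
        rw [ENNReal.tsum_eq_iSup_sum]
        exact iSup_le hfin
    _ = _ := by
        rw [← ENNReal.mul_rpow_of_nonneg _ _ (by positivity), ← mul_assoc]
        congr 2
        rw [show q + 2 = 1 + (q + 1) by ring,
          ENNReal.rpow_add_of_nonneg 1 _ zero_le_one (by positivity), ENNReal.rpow_one]

end Lower

/-! ### From a measure space to the line -/

section UpperMeasureSpace

variable {X : Type*} [MeasureSpace X] {p : ℝ≥0∞} {w : X → ℝ≥0∞} {ρ : X → ℝ} {ω : Measure ℝ}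
  {q : ℝ} {g : X → ℝ≥0∞}

/-- The image under `ρ` of the measure with density `g`. -/
noncomputable def radialMeasure (ρ : X → ℝ) (g : X → ℝ≥0∞) : Measure ℝ :=
  (volume.withDensity g).map ρ

theorem radialMeasure_apply (hρ : Measurable ρ) (g : X → ℝ≥0∞) {E : Set ℝ}
    (hE : MeasurableSet E) : radialMeasure ρ g E = ∫⁻ x in ρ ⁻¹' E, g x := by
  rw [radialMeasure, Measure.map_apply hρ hE, withDensity_apply _ (hρ hE)]

theorem nullSingletonClass_radialMeasure (hρ : Measurable ρ)
    (hρ0 : ∀ t, volume (ρ ⁻¹' {t}) = 0) (g : X → ℝ≥0∞) :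
    NullSingletonClass (radialMeasure ρ g) where
  measure_singleton t := by
    rw [radialMeasure_apply hρ g (measurableSet_singleton t), setLIntegral_measure_zero _ _ (hρ0 t)]

theorem radialMeasure_le_rpow_mul_dualNorm (hp : 1 ≤ p) (hp' : p ≠ ∞) (hw : AEMeasurable w)
    (hw' : ∀ x, w x ≠ ∞) (hρ : Measurable ρ) (hg : AEMeasurable g) {t : ℝ}
    (ht : dualNorm p w (ρ ⁻¹' Set.Ici t) ≠ ∞) {E : Set ℝ} (hE : MeasurableSet E)
    (hEt : E ⊆ Set.Ici t) :
    radialMeasure ρ g E ≤ radialMeasure ρ (fun x => g x ^ p.toReal * w x) E ^ (1 / p.toReal) *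
      dualNorm p w (ρ ⁻¹' Set.Ici t) := by
  have hsub := dualNorm_mono p w (Set.preimage_mono (f := ρ) hEt)
  rw [radialMeasure_apply hρ _ hE, radialMeasure_apply hρ _ hE]
  refine (setLIntegral_le_mul_dualNorm hp hp' hw hw' hg (ne_top_of_le_ne_top ht hsub)).trans ?_
  gcongr

theorem lintegral_setLIntegral_rpow_le_of_le [NullSingletonClass ω] (hp : 1 ≤ p) (hp' : p ≠ ∞)
    (hpq : p.toReal ≤ q) (hw : AEMeasurable w) (hw' : ∀ x, w x ≠ ∞) (hρ : Measurable ρ)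
    (hρ0 : ∀ t, volume (ρ ⁻¹' {t}) = 0) (hV0 : ∀ t, dualNorm p w (ρ ⁻¹' Set.Ici t) ≠ 0)
    {D : ℝ≥0∞} (hDtop : D ≠ ∞)
    (hD : ∀ t, ω (Set.Iio t) ^ (1 / q) * dualNorm p w (ρ ⁻¹' Set.Ici t) ≤ D)
    (hg : AEMeasurable g) :
    ∫⁻ t, (∫⁻ x in ρ ⁻¹' Set.Ici t, g x) ^ q ∂ω ≤
      (4 * D * (∫⁻ x, g x ^ p.toReal * w x) ^ (1 / p.toReal)) ^ q := by
  have := nullSingletonClass_radialMeasure hρ hρ0 g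
  have h := lintegral_measure_Ici_rpow_le_of_le
    (ENNReal.toReal_pos (zero_lt_one.trans_le hp).ne' hp') hpq hV0
    (fun t ht E hE hEt => radialMeasure_le_rpow_mul_dualNorm hp hp' hw hw' hρ hg ht hE hEt)
    hDtop hD
  simpa only [radialMeasure_apply hρ _ measurableSet_Ici,
    radialMeasure_apply hρ _ MeasurableSet.univ, Set.preimage_univ, Measure.restrict_univ] using h

theorem lintegral_setLIntegral_rpow_le_of_lt [NullSingletonClass ω] {r : ℝ} (hp : 1 ≤ p)
    (hp' : p ≠ ∞) (hq : 0 < q) (hr : 0 < r) (hrpq : 1 / r = 1 / q - 1 / p.toReal)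
    (hw : AEMeasurable w) (hw' : ∀ x, w x ≠ ∞) (hρ : Measurable ρ)
    (hρ0 : ∀ t, volume (ρ ⁻¹' {t}) = 0) (hV0 : ∀ t, dualNorm p w (ρ ⁻¹' Set.Ici t) ≠ 0)
    {D : ℝ≥0∞} (hDtop : D ≠ ∞)
    (hD : ∫⁻ t, ω (Set.Iio t) ^ (r / p.toReal) * dualNorm p w (ρ ⁻¹' Set.Ici t) ^ r ∂ω ≤ D ^ r)
    (hg : AEMeasurable g) :
    ∫⁻ t, (∫⁻ x in ρ ⁻¹' Set.Ici t, g x) ^ q ∂ω ≤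
      2 * (4 * D * (∫⁻ x, g x ^ p.toReal * w x) ^ (1 / p.toReal)) ^ q := by
  have := nullSingletonClass_radialMeasure hρ hρ0 g
  have h := lintegral_measure_Ici_rpow_le_of_lt
    (ENNReal.toReal_pos (zero_lt_one.trans_le hp).ne' hp') hq hr hrpq
    (fun s t hst => dualNorm_mono p w (Set.preimage_mono (Set.Ici_subset_Ici.2 hst))) hV0
    (fun t ht E hE hEt => radialMeasure_le_rpow_mul_dualNorm hp hp' hw hw' hρ hg ht hE hEt)
    hDtop hD
  simpa only [radialMeasure_apply hρ _ measurableSet_Ici,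
    radialMeasure_apply hρ _ MeasurableSet.univ, Set.preimage_univ, Measure.restrict_univ] using h

end UpperMeasureSpace

/-! ### Eliminating the first function -/

section Reduction

variable {n : ℕ} {q : ℝ} {p : ℝ≥0∞} {u : ℝ → ℝ} {v v₁ v₂ : EuclideanSpace ℝ (Fin n) → ℝ}

theorem ballCompl_eq_preimage (n : ℕ) (t : ℝ) : ballCompl n t = norm ⁻¹' Set.Ici t := by
  ext x; simp [ballCompl]

theorem ballCompl_subset_ballCompl {s t : ℝ} (h : s ≤ t) : ballCompl n t ⊆ ballCompl n s :=
  Set.compl_subset_compl.2 (Metric.ball_subset_ball h)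

theorem antitone_setLIntegral_ballCompl (f : EuclideanSpace ℝ (Fin n) → ℝ≥0∞) :
    Antitone fun t => ∫⁻ x in ballCompl n t, f x :=
  fun _ _ h => lintegral_mono_set (ballCompl_subset_ballCompl h)

theorem volume_norm_preimage_singleton (hn : 1 ≤ n) (t : ℝ) :
    volume ((norm : EuclideanSpace ℝ (Fin n) → ℝ) ⁻¹' {t}) = 0 := by
  have : Nonempty (Fin n) := ⟨⟨0, hn⟩⟩
  have h : (norm : EuclideanSpace ℝ (Fin n) → ℝ) ⁻¹' {t} = Metric.sphere 0 t := by
    ext x; simp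
  rw [h, Measure.addHaar_sphere]

theorem volume_ballCompl_ne_zero (hn : 1 ≤ n) (t : ℝ) : volume (ballCompl n t) ≠ 0 := by
  have : Nonempty (Fin n) := ⟨⟨0, hn⟩⟩
  have htop : volume (Set.univ : Set (EuclideanSpace ℝ (Fin n))) = ∞ :=
    measure_univ_of_isAddLeftInvariant _
  intro h
  have := measure_add_measure_compl (μ := (volume : Measure (EuclideanSpace ℝ (Fin n))))
    (measurableSet_ball (x := 0) (ε := t))
  rw [htop, show volume (Metric.ball (0 : EuclideanSpace ℝ (Fin n)) t)ᶜ = 0 from h,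
    add_zero] at this
  exact measure_ball_lt_top.ne this

theorem negPowNorm_one_one (v : EuclideanSpace ℝ (Fin n) → ℝ) (t : ℝ) :
    negPowNorm 1 1 v t = ∫⁻ x in ballCompl n t, (ENNReal.ofReal (v x))⁻¹ := by
  simp [negPowNorm, weightedNorm, ENNReal.rpow_neg_one]

theorem negPowNorm_eq_dualNorm (p : ℝ≥0∞) (v : EuclideanSpace ℝ (Fin n) → ℝ) (t : ℝ) :
    negPowNorm p.conjExponent (1 / p.toReal) v t =
      dualNorm p (fun x => ENNReal.ofReal (v x)) (norm ⁻¹' Set.Ici t) := by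
  rw [← ballCompl_eq_preimage]; rfl

theorem IsWeight.aemeasurable_ofReal (hv : IsWeight Set.univ v) :
    AEMeasurable fun x => ENNReal.ofReal (v x) := by
  have := hv.locallyIntegrableOn.aestronglyMeasurable
  rw [Measure.restrict_univ] at this
  exact this.aemeasurable.ennreal_ofReal

theorem IsWeight.aemeasurable_inv_ofReal (hv : IsWeight Set.univ v) :
    AEMeasurable fun x => (ENNReal.ofReal (v x))⁻¹ :=
  hv.aemeasurable_ofReal.inv

theorem negPowNorm_one_one_ne_zero (hn : 1 ≤ n) (hv : IsWeight Set.univ v) (t : ℝ) :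
    negPowNorm 1 1 v t ≠ 0 := by
  have hv' := hv.aemeasurable_inv_ofReal
  rw [negPowNorm_one_one]
  intro h
  rw [lintegral_eq_zero_iff' hv'.restrict] at h
  have : (ae (volume.restrict (ballCompl n t))).NeBot := by
    rw [ae_neBot, Ne, Measure.restrict_eq_zero]
    exact volume_ballCompl_ne_zero hn t
  obtain ⟨x, hx⟩ := h.exists
  simp at hx

/-- Hölder's inequality with exponents `∞` and `1`. For `‖v⁻¹‖ = ∞` it may fail, since `f` may be
infinite where `v = 0` and still have norm zero. -/
theorem setLIntegral_le_mul_negPowNorm (hv : IsWeight Set.univ v)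
    (f : EuclideanSpace ℝ (Fin n) → ℝ≥0∞) {t : ℝ} (ht : negPowNorm 1 1 v t ≠ ∞) :
    ∫⁻ x in ballCompl n t, f x ≤
      weightedNorm ∞ (fun x => ENNReal.ofReal (v x)) Set.univ f * negPowNorm 1 1 v t := by
  have hv' := hv.aemeasurable_inv_ofReal
  rw [negPowNorm_one_one] at ht ⊢
  rw [← lintegral_const_mul'' _ hv'.restrict]
  have h1 : ∀ᵐ x ∂volume.restrict (ballCompl n t), f x * ENNReal.ofReal (v x) ≤
      weightedNorm ∞ (fun x => ENNReal.ofReal (v x)) Set.univ f := by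
    refine ae_restrict_of_ae ?_
    have := ENNReal.ae_le_essSup (μ := volume) fun x => f x * ENNReal.ofReal (v x)
    simpa [weightedNorm] using this
  refine lintegral_mono_ae ?_
  filter_upwards [h1, ae_lt_top' hv'.restrict ht] with x hx hfin
  have h0 : ENNReal.ofReal (v x) ≠ 0 := fun h0 => by simp [h0] at hfin
  calc f x = f x * ENNReal.ofReal (v x) * (ENNReal.ofReal (v x))⁻¹ := by
        rw [mul_assoc, ENNReal.mul_inv_cancel h0 ENNReal.ofReal_ne_top, mul_one]
    _ ≤ _ := by gcongr

/-- The function `v⁻¹` is extremal among all `f` with `‖f‖_{∞, v} ≤ 1`, as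
`setLIntegral_le_mul_negPowNorm` shows. -/
theorem weightedNorm_top_inv_le_one (v : EuclideanSpace ℝ (Fin n) → ℝ) :
    weightedNorm ∞ (fun x => ENNReal.ofReal (v x)) Set.univ
      (fun x => (ENNReal.ofReal (v x))⁻¹) ≤ 1 := by
  simp only [weightedNorm, if_true]
  exact essSup_le_of_ae_le _ (Filter.Eventually.of_forall fun x => ENNReal.inv_mul_le_one _)

/-- The measure `u(t) dt` on `(0, ∞)`. -/
noncomputable def weightMeasure (u : ℝ → ℝ) : Measure ℝ :=
  (volume.restrict (Set.Ioi 0)).withDensity fun t => ENNReal.ofReal (u t)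

instance nullSingletonClass_weightMeasure (u : ℝ → ℝ) : NullSingletonClass (weightMeasure u) := by
  unfold weightMeasure; infer_instance

theorem setLIntegral_Ioi_mul_ofReal (hu : IsWeight (Set.Ioi 0) u) {φ : ℝ → ℝ≥0∞}
    (hφ : Measurable φ) :
    ∫⁻ t in Set.Ioi (0 : ℝ), φ t * ENNReal.ofReal (u t) = ∫⁻ t, φ t ∂weightMeasure u := by
  have hu' := hu.locallyIntegrableOn.aestronglyMeasurable.aemeasurable.ennreal_ofReal
  rw [weightMeasure, lintegral_withDensity_eq_lintegral_mul₀ hu' hφ.aemeasurable]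
  simp only [Pi.mul_apply, mul_comm]

theorem bilinearLHS_eq (hu : IsWeight (Set.Ioi 0) u) (f g : EuclideanSpace ℝ (Fin n) → ℝ≥0∞) :
    bilinearLHS q u f g = (∫⁻ t, ((∫⁻ x in ballCompl n t, f x) *
      ∫⁻ x in ballCompl n t, g x) ^ q ∂weightMeasure u) ^ (1 / q) := by
  rw [bilinearLHS, setLIntegral_Ioi_mul_ofReal hu]
  exact ((antitone_setLIntegral_ballCompl f).measurable.mul
    (antitone_setLIntegral_ballCompl g).measurable).pow_const _

/-- The measure `u(t) ‖v⁻¹‖_{1, ᶜB(0,t)} ^ q dt` on `(0, ∞)`. -/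
noncomputable def hardyMeasure (q : ℝ) (u : ℝ → ℝ) (v : EuclideanSpace ℝ (Fin n) → ℝ) :
    Measure ℝ :=
  (weightMeasure u).withDensity fun t => negPowNorm 1 1 v t ^ q

instance nullSingletonClass_hardyMeasure (q : ℝ) (u : ℝ → ℝ)
    (v : EuclideanSpace ℝ (Fin n) → ℝ) : NullSingletonClass (hardyMeasure q u v) := by
  unfold hardyMeasure; infer_instance

theorem measurable_negPowNorm_one_one (v : EuclideanSpace ℝ (Fin n) → ℝ) :
    Measurable fun t => negPowNorm 1 1 v t := by
  simp only [negPowNorm_one_one]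
  exact (antitone_setLIntegral_ballCompl _).measurable

theorem lintegral_hardyMeasure (v : EuclideanSpace ℝ (Fin n) → ℝ) {φ : ℝ → ℝ≥0∞}
    (hφ : Measurable φ) :
    ∫⁻ t, φ t ∂hardyMeasure q u v = ∫⁻ t, negPowNorm 1 1 v t ^ q * φ t ∂weightMeasure u := by
  rw [hardyMeasure, lintegral_withDensity_eq_lintegral_mul _
    ((measurable_negPowNorm_one_one v).pow_const q) hφ]
  rfl

theorem hardyMeasure_Iio (hu : IsWeight (Set.Ioi 0) u) (v : EuclideanSpace ℝ (Fin n) → ℝ)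
    (t : ℝ) : hardyMeasure q u v (Set.Iio t) =
      ∫⁻ y in Set.Ioo 0 t, ENNReal.ofReal (u y) * negPowNorm 1 1 v y ^ q := by
  have hm : Measurable fun t => negPowNorm 1 1 v t ^ q :=
    (measurable_negPowNorm_one_one v).pow_const q
  rw [hardyMeasure, withDensity_apply _ measurableSet_Iio, ← lintegral_indicator measurableSet_Iio,
    ← setLIntegral_Ioi_mul_ofReal hu (hm.indicator measurableSet_Iio), ← Set.Ioi_inter_Iio,
    Set.inter_comm, ← Measure.restrict_restrict measurableSet_Iio,
    ← lintegral_indicator measurableSet_Iio]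
  refine lintegral_congr fun y => ?_
  by_cases hy : y ∈ Set.Iio t
  · simp only [Set.indicator_of_mem hy, mul_comm]
  · simp only [Set.indicator_of_notMem hy, zero_mul]

/-- The set where `‖v⁻¹‖ = ∞` has infinite `hardyMeasure` below `t` unless it is `u(t) dt`-null
there. -/
theorem ae_negPowNorm_ne_top (hq : 0 < q)
    (hω : ∀ t, hardyMeasure q u v (Set.Iio t) ≠ ∞) :
    ∀ᵐ t ∂weightMeasure u, negPowNorm 1 1 v t ≠ ∞ := by
  have hm := measurable_negPowNorm_one_one v
  have hS : MeasurableSet {t | negPowNorm 1 1 v t = ∞} := hm (measurableSet_singleton _)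
  -- `∞ * u`-measure of `{s < t | ‖v⁻¹‖ = ∞}` is at most the finite number `hardyMeasure (Iio t)`.
  have h0 : (weightMeasure u).restrict {t | negPowNorm 1 1 v t = ∞} Set.univ ≤ 0 := by
    refine measure_le_of_forall_measure_Iio_le fun t _ => ?_
    rw [Measure.restrict_apply measurableSet_Iio]
    have h1 : ∫⁻ _ in Set.Iio t ∩ {t | negPowNorm 1 1 v t = ∞}, ∞ ∂weightMeasure u ≤
        hardyMeasure q u v (Set.Iio t) := by
      rw [hardyMeasure, withDensity_apply _ measurableSet_Iio]
      refine (setLIntegral_mono' (measurableSet_Iio.inter hS) fun s hs => ?_).trans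
        (lintegral_mono_set Set.inter_subset_left)
      rw [show negPowNorm 1 1 v s = ∞ from hs.2, ENNReal.top_rpow_of_pos hq]
    rw [setLIntegral_const] at h1
    by_contra h
    rw [ENNReal.top_mul (by simpa using h)] at h1
    exact hω t (top_le_iff.1 h1)
  rw [ae_iff]
  simpa using h0

theorem lintegral_mul_setLIntegral_rpow (hq : 0 < q) (v : EuclideanSpace ℝ (Fin n) → ℝ)
    (g : EuclideanSpace ℝ (Fin n) → ℝ≥0∞) :
    ∫⁻ t, (negPowNorm 1 1 v t * ∫⁻ x in ballCompl n t, g x) ^ q ∂weightMeasure u =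
      ∫⁻ t, (∫⁻ x in norm ⁻¹' Set.Ici t, g x) ^ q ∂hardyMeasure q u v := by
  simp only [← ballCompl_eq_preimage, ENNReal.mul_rpow_of_nonneg _ _ hq.le]
  rw [lintegral_hardyMeasure]
  exact (antitone_setLIntegral_ballCompl g).measurable.pow_const _

/-- Insert `f = v₁⁻¹` into the bilinear inequality. -/
theorem HardyIneq.lintegral_rpow_le (hq : 0 < q) (hp' : p ≠ ∞) (hu : IsWeight (Set.Ioi 0) u)
    (hv₁ : IsWeight Set.univ v₁) {C : ℝ≥0} (hC : HardyIneq q ∞ p u v₁ v₂ C)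
    {g : EuclideanSpace ℝ (Fin n) → ℝ≥0∞} (hg : Measurable g) :
    ∫⁻ t, (∫⁻ x in norm ⁻¹' Set.Ici t, g x) ^ q ∂hardyMeasure q u v₁ ≤
      (C * (∫⁻ x, g x ^ p.toReal * ENNReal.ofReal (v₂ x)) ^ (1 / p.toReal)) ^ q := by
  have h := hC (fun x => (ENNReal.ofReal (v₁ x))⁻¹) g hv₁.aemeasurable_inv_ofReal hg.aemeasurable
  rw [bilinearLHS_eq hu] at h
  simp only [← negPowNorm_one_one] at h
  rw [lintegral_mul_setLIntegral_rpow hq, one_div, ENNReal.rpow_inv_le_iff hq] at h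
  refine h.trans (ENNReal.rpow_le_rpow ?_ hq.le)
  calc C * weightedNorm ∞ (fun x => ENNReal.ofReal (v₁ x)) Set.univ
        (fun x => (ENNReal.ofReal (v₁ x))⁻¹) *
          weightedNorm p (fun x => ENNReal.ofReal (v₂ x)) Set.univ g
      ≤ C * 1 * weightedNorm p (fun x => ENNReal.ofReal (v₂ x)) Set.univ g := by
        gcongr
        exact weightedNorm_top_inv_le_one v₁
    _ = _ := by simp [weightedNorm, hp']

/-- The converse of `HardyIneq.lintegral_rpow_le`: `v₁⁻¹` is the extremal choice of `f`.
Finiteness of `hardyMeasure` on bounded intervals excludes the points with `‖v₁⁻¹‖ = ∞`. -/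
theorem hardyIneq_of_lintegral_rpow_le (hq : 0 < q) (hp' : p ≠ ∞) (hu : IsWeight (Set.Ioi 0) u)
    (hv₁ : IsWeight Set.univ v₁) {C : ℝ≥0} (hω : ∀ t, hardyMeasure q u v₁ (Set.Iio t) ≠ ∞)
    (hI : ∀ g : EuclideanSpace ℝ (Fin n) → ℝ≥0∞, AEMeasurable g →
      ∫⁻ t, (∫⁻ x in norm ⁻¹' Set.Ici t, g x) ^ q ∂hardyMeasure q u v₁ ≤
        (C * (∫⁻ x, g x ^ p.toReal * ENNReal.ofReal (v₂ x)) ^ (1 / p.toReal)) ^ q) :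
    HardyIneq q ∞ p u v₁ v₂ C := by
  intro f g _ hg
  set A := weightedNorm ∞ (fun x => ENNReal.ofReal (v₁ x)) Set.univ f
  have hB : weightedNorm p (fun x => ENNReal.ofReal (v₂ x)) Set.univ g =
      (∫⁻ x, g x ^ p.toReal * ENNReal.ofReal (v₂ x)) ^ (1 / p.toReal) := by
    simp [weightedNorm, hp']
  rw [bilinearLHS_eq hu, one_div, ENNReal.rpow_inv_le_iff hq, hB]
  calc ∫⁻ t, ((∫⁻ x in ballCompl n t, f x) * ∫⁻ x in ballCompl n t, g x) ^ q ∂weightMeasure u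
      ≤ ∫⁻ t, A ^ q * (negPowNorm 1 1 v₁ t * ∫⁻ x in ballCompl n t, g x) ^ q ∂weightMeasure u := by
        refine lintegral_mono_ae ((ae_negPowNorm_ne_top hq hω).mono fun t ht => ?_)
        rw [← ENNReal.mul_rpow_of_nonneg _ _ hq.le, ← mul_assoc]
        gcongr
        exact setLIntegral_le_mul_negPowNorm hv₁ f ht
    _ = A ^ q * ∫⁻ t, (∫⁻ x in norm ⁻¹' Set.Ici t, g x) ^ q ∂hardyMeasure q u v₁ := by
        rw [lintegral_const_mul, lintegral_mul_setLIntegral_rpow hq]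
        exact ((measurable_negPowNorm_one_one v₁).mul
          (antitone_setLIntegral_ballCompl g).measurable).pow_const _
    _ ≤ A ^ q * (C * (∫⁻ x, g x ^ p.toReal * ENNReal.ofReal (v₂ x)) ^ (1 / p.toReal)) ^ q := by
        gcongr
        exact hI g hg
    _ = _ := by
        rw [← ENNReal.mul_rpow_of_nonneg _ _ hq.le, ← mul_assoc, mul_comm A]

theorem D₂_eq {r : ℝ} (hu : IsWeight (Set.Ioi 0) u) (p : ℝ≥0∞)
    (v₁ v₂ : EuclideanSpace ℝ (Fin n) → ℝ) :
    D₂ q p r u v₁ v₂ = (∫⁻ t, hardyMeasure q u v₁ (Set.Iio t) ^ (r / p.toReal) *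
      dualNorm p (fun x => ENNReal.ofReal (v₂ x)) (norm ⁻¹' Set.Ici t) ^ r
        ∂hardyMeasure q u v₁) ^ (1 / r) := by
  have hV : Measurable fun t =>
      dualNorm p (fun x => ENNReal.ofReal (v₂ x)) (norm ⁻¹' Set.Ici t) :=
    Antitone.measurable fun s t hst =>
      dualNorm_mono p _ (Set.preimage_mono (Set.Ici_subset_Ici.2 hst))
  have hI : Measurable fun t => hardyMeasure q u v₁ (Set.Iio t) ^ (r / p.toReal) *
      dualNorm p (fun x => ENNReal.ofReal (v₂ x)) (norm ⁻¹' Set.Ici t) ^ r :=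
    ((monotone_measure_Iio _).measurable.pow_const _).mul (hV.pow_const _)
  have hFI : Measurable fun t => negPowNorm 1 1 v₁ t ^ q *
      (hardyMeasure q u v₁ (Set.Iio t) ^ (r / p.toReal) *
        dualNorm p (fun x => ENNReal.ofReal (v₂ x)) (norm ⁻¹' Set.Ici t) ^ r) :=
    ((measurable_negPowNorm_one_one v₁).pow_const q).mul hI
  rw [D₂, lintegral_hardyMeasure v₁ hI, ← setLIntegral_Ioi_mul_ofReal hu hFI]
  simp only [hardyMeasure_Iio hu, negPowNorm_eq_dualNorm]
  congr 2
  funext t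
  ring

theorem rpow_hardyMeasure_mul_dualNorm_le_D₁ (hq : 0 < q) (hu : IsWeight (Set.Ioi 0) u)
    (p : ℝ≥0∞) (v₁ v₂ : EuclideanSpace ℝ (Fin n) → ℝ) (t : ℝ) :
    hardyMeasure q u v₁ (Set.Iio t) ^ (1 / q) *
      dualNorm p (fun x => ENNReal.ofReal (v₂ x)) (norm ⁻¹' Set.Ici t) ≤ D₁ q p u v₁ v₂ := by
  rw [hardyMeasure_Iio hu, ← negPowNorm_eq_dualNorm]
  rcases lt_or_ge 0 t with ht | ht
  · exact le_iSup₂_of_le t ht le_rfl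
  · simp [Set.Ioo_eq_empty (not_lt.2 ht), hq]

/-! ### Two-sided bounds and the best constant -/

theorem characterization_of_bounds {p₁ p₂ : ℝ≥0∞} {c₁ c₂ : ℝ≥0} (hc₁ : 0 < c₁) (hc₂ : 0 < c₂)
    {D : ℝ≥0∞} (hlow : ∀ C : ℝ≥0, HardyIneq q p₁ p₂ u v₁ v₂ C → c₁ * D ≤ C)
    (hup : ∀ C : ℝ≥0, D ≠ ∞ → C = c₂ * D → HardyIneq q p₁ p₂ u v₁ v₂ C) :
    ((∃ C : ℝ≥0, HardyIneq q p₁ p₂ u v₁ v₂ C) ↔ D < ∞) ∧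
      c₁ * D ≤ bestConstant q p₁ p₂ u v₁ v₂ ∧ bestConstant q p₁ p₂ u v₁ v₂ ≤ c₂ * D := by
  have hex (hD : D ≠ ∞) : ∃ C : ℝ≥0, (C : ℝ≥0∞) = c₂ * D :=
    ⟨(c₂ * D).toNNReal, ENNReal.coe_toNNReal (ENNReal.mul_ne_top ENNReal.coe_ne_top hD)⟩
  refine ⟨⟨fun ⟨C, hC⟩ => lt_top_iff_ne_top.2 fun hD => ?_, fun hD => ?_⟩, ?_, ?_⟩
  · have := hlow C hC
    rw [hD, ENNReal.mul_top (by exact_mod_cast hc₁.ne')] at this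
    exact ENNReal.coe_ne_top (top_le_iff.1 this)
  · obtain ⟨C, hC⟩ := hex hD.ne
    exact ⟨C, hup C hD.ne hC⟩
  · exact le_iInf₂ hlow
  · by_cases hD : D = ∞
    · rw [hD, ENNReal.mul_top (by exact_mod_cast hc₂.ne')]
      exact le_top
    · obtain ⟨C, hC⟩ := hex hD
      exact (iInf₂_le C (hup C hD hC)).trans_eq hC

/-! ### The case of two essential suprema -/

theorem D₃_eq (hu : IsWeight (Set.Ioi 0) u) (hq : 0 < q)
    (v₁ v₂ : EuclideanSpace ℝ (Fin n) → ℝ) :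
    D₃ q u v₁ v₂ =
      (∫⁻ t, (negPowNorm 1 1 v₁ t * negPowNorm 1 1 v₂ t) ^ q ∂weightMeasure u) ^ (1 / q) := by
  have hm : Measurable fun t => (negPowNorm 1 1 v₁ t * negPowNorm 1 1 v₂ t) ^ q :=
    ((measurable_negPowNorm_one_one v₁).mul (measurable_negPowNorm_one_one v₂)).pow_const q
  rw [D₃, ← setLIntegral_Ioi_mul_ofReal hu hm]
  congr 2
  funext t
  rw [ENNReal.mul_rpow_of_nonneg _ _ hq.le]
  ring

theorem D₃_le_of_hardyIneq (hq : 0 < q) (hu : IsWeight (Set.Ioi 0) u)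
    (hv₁ : IsWeight Set.univ v₁) (hv₂ : IsWeight Set.univ v₂) {C : ℝ≥0}
    (hC : HardyIneq q ∞ ∞ u v₁ v₂ C) : D₃ q u v₁ v₂ ≤ C := by
  have h := hC (fun x => (ENNReal.ofReal (v₁ x))⁻¹) (fun x => (ENNReal.ofReal (v₂ x))⁻¹)
    hv₁.aemeasurable_inv_ofReal hv₂.aemeasurable_inv_ofReal
  rw [bilinearLHS_eq hu] at h
  simp only [← negPowNorm_one_one, ← D₃_eq hu hq] at h
  refine h.trans ?_
  rw [mul_assoc]
  exact mul_le_of_le_one_right' (mul_le_one' (weightedNorm_top_inv_le_one v₁)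
    (weightedNorm_top_inv_le_one v₂))

/-- For almost every `t` with respect to `u(t) dt`, finiteness of `D₃` makes both `‖v₁⁻¹‖` and
`‖v₂⁻¹‖` finite, because neither of them vanishes. -/
theorem hardyIneq_of_D₃_le (hn : 1 ≤ n) (hq : 0 < q) (hu : IsWeight (Set.Ioi 0) u)
    (hv₁ : IsWeight Set.univ v₁) (hv₂ : IsWeight Set.univ v₂) {C : ℝ≥0}
    (hC : D₃ q u v₁ v₂ ≤ C) : HardyIneq q ∞ ∞ u v₁ v₂ C := by
  intro f g _ _
  set A := weightedNorm ∞ (fun x => ENNReal.ofReal (v₁ x)) Set.univ f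
  set B := weightedNorm ∞ (fun x => ENNReal.ofReal (v₂ x)) Set.univ g
  have hm : Measurable fun t => (negPowNorm 1 1 v₁ t * negPowNorm 1 1 v₂ t) ^ q :=
    ((measurable_negPowNorm_one_one v₁).mul (measurable_negPowNorm_one_one v₂)).pow_const q
  rw [D₃_eq hu hq, one_div, ENNReal.rpow_inv_le_iff hq] at hC
  have hfin := ae_lt_top hm
    (ne_top_of_le_ne_top (ENNReal.rpow_ne_top_of_nonneg hq.le ENNReal.coe_ne_top) hC)
  rw [bilinearLHS_eq hu, one_div, ENNReal.rpow_inv_le_iff hq]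
  calc ∫⁻ t, ((∫⁻ x in ballCompl n t, f x) * ∫⁻ x in ballCompl n t, g x) ^ q ∂weightMeasure u
      ≤ ∫⁻ t, (A * B) ^ q * (negPowNorm 1 1 v₁ t * negPowNorm 1 1 v₂ t) ^ q
          ∂weightMeasure u := by
        refine lintegral_mono_ae (hfin.mono fun t ht => ?_)
        have hne : negPowNorm 1 1 v₁ t * negPowNorm 1 1 v₂ t ≠ ∞ := by
          intro h
          rw [h, ENNReal.top_rpow_of_pos hq] at ht
          exact lt_irrefl _ ht
        have h1 : negPowNorm 1 1 v₁ t ≠ ∞ := fun h =>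
          hne (by rw [h, ENNReal.top_mul (negPowNorm_one_one_ne_zero hn hv₂ t)])
        have h2 : negPowNorm 1 1 v₂ t ≠ ∞ := fun h =>
          hne (by rw [h, ENNReal.mul_top (negPowNorm_one_one_ne_zero hn hv₁ t)])
        rw [← ENNReal.mul_rpow_of_nonneg _ _ hq.le, mul_mul_mul_comm]
        gcongr
        · exact setLIntegral_le_mul_negPowNorm hv₁ f h1
        · exact setLIntegral_le_mul_negPowNorm hv₂ g h2
    _ = (A * B) ^ q * ∫⁻ t, (negPowNorm 1 1 v₁ t * negPowNorm 1 1 v₂ t) ^ q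
          ∂weightMeasure u := lintegral_const_mul _ hm
    _ ≤ (A * B) ^ q * (C : ℝ≥0∞) ^ q := by gcongr
    _ = _ := by
        rw [← ENNReal.mul_rpow_of_nonneg _ _ hq.le]
        congr 1
        ring

end Reduction

/-! ### The case of a finite second exponent -/

section Finite

variable {n : ℕ} {q : ℝ} {p : ℝ≥0∞} {u : ℝ → ℝ} {v₁ v₂ : EuclideanSpace ℝ (Fin n) → ℝ}

theorem dualNorm_norm_preimage_ne_zero (hn : 1 ≤ n) (hp : 1 ≤ p) (hp' : p ≠ ∞)
    (hv₂ : IsWeight Set.univ v₂) (t : ℝ) :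
    dualNorm p (fun x => ENNReal.ofReal (v₂ x)) (norm ⁻¹' Set.Ici t) ≠ 0 :=
  dualNorm_ne_zero hp hp' hv₂.aemeasurable_ofReal (fun _ => ENNReal.ofReal_ne_top)
    (by rw [← ballCompl_eq_preimage]; exact volume_ballCompl_ne_zero hn t)

theorem D₁_le_of_hardyIneq (hq : 0 < q) (hp : 1 ≤ p) (hp' : p ≠ ∞)
    (hu : IsWeight (Set.Ioi 0) u) (hv₁ : IsWeight Set.univ v₁) (hv₂ : IsWeight Set.univ v₂)
    {C : ℝ≥0} (hC : HardyIneq q ∞ p u v₁ v₂ C) : D₁ q p u v₁ v₂ ≤ C := by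
  refine iSup₂_le fun t _ => ?_
  rw [← hardyMeasure_Iio hu, negPowNorm_eq_dualNorm]
  exact rpow_measure_Iio_mul_dualNorm_le hp hp' hq hv₂.aemeasurable_ofReal measurable_norm
    (fun g hg => hC.lintegral_rpow_le hq hp' hu hv₁ hg) t

theorem hardyIneq_of_four_mul_D₁_le (hn : 1 ≤ n) (hq : 0 < q) (hp : 1 ≤ p) (hp' : p ≠ ∞)
    (hpq : p.toReal ≤ q) (hu : IsWeight (Set.Ioi 0) u) (hv₁ : IsWeight Set.univ v₁)
    (hv₂ : IsWeight Set.univ v₂) {C : ℝ≥0} (hD : D₁ q p u v₁ v₂ ≠ ∞)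
    (hC : 4 * D₁ q p u v₁ v₂ ≤ C) : HardyIneq q ∞ p u v₁ v₂ C := by
  have hle := rpow_hardyMeasure_mul_dualNorm_le_D₁ (q := q) hq hu p v₁ v₂
  have hV0 := dualNorm_norm_preimage_ne_zero hn hp hp' hv₂
  refine hardyIneq_of_lintegral_rpow_le hq hp' hu hv₁ (fun t ht => ?_) fun g hg => ?_
  · have := hle t
    rw [ht, ENNReal.top_rpow_of_pos (by positivity), ENNReal.top_mul (hV0 t)] at this
    exact hD (top_le_iff.1 this)
  · refine (lintegral_setLIntegral_rpow_le_of_le hp hp' hpq hv₂.aemeasurable_ofReal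
      (fun _ => ENNReal.ofReal_ne_top) measurable_norm (volume_norm_preimage_singleton hn) hV0 hD
      hle hg).trans ?_
    gcongr

theorem D₂_le_of_hardyIneq {r : ℝ} (hn : 1 ≤ n) (hq : 0 < q) (hp : 1 ≤ p) (hp' : p ≠ ∞)
    (hr : 0 < r) (hrpq : 1 / r = 1 / q - 1 / p.toReal)
    (hu : IsWeight (Set.Ioi 0) u) (hv₁ : IsWeight Set.univ v₁) (hv₂ : IsWeight Set.univ v₂)
    {C : ℝ≥0} (hC : HardyIneq q ∞ p u v₁ v₂ C) :
    D₂ q p r u v₁ v₂ ≤ 2 ^ ((q + 2) / q) * C := by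
  have h := lintegral_rpow_measure_Iio_mul_dualNorm_le hp hp' hq hr hrpq hv₂.aemeasurable_ofReal
    measurable_norm (dualNorm_norm_preimage_ne_zero hn hp hp' hv₂) ENNReal.coe_ne_top
    (fun g hg => hC.lintegral_rpow_le hq hp' hu hv₁ hg)
  rw [D₂_eq hu]
  refine (ENNReal.rpow_le_rpow h (by positivity)).trans_eq ?_
  rw [← ENNReal.rpow_mul, show r / q * (1 / r) = 1 / q by field_simp,
    ENNReal.mul_rpow_of_nonneg _ _ (by positivity), ← ENNReal.rpow_mul, ← ENNReal.rpow_mul,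
    mul_one_div_cancel hq.ne', ENNReal.rpow_one, mul_one_div]

theorem hardyIneq_of_mul_D₂_le {r : ℝ} (hn : 1 ≤ n) (hq : 0 < q) (hp : 1 ≤ p) (hp' : p ≠ ∞)
    (hr : 0 < r) (hrpq : 1 / r = 1 / q - 1 / p.toReal) (hu : IsWeight (Set.Ioi 0) u)
    (hv₁ : IsWeight Set.univ v₁) (hv₂ : IsWeight Set.univ v₂) {C : ℝ≥0}
    (hD : D₂ q p r u v₁ v₂ ≠ ∞) (hC : 2 ^ (1 / q) * 4 * D₂ q p r u v₁ v₂ ≤ C) :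
    HardyIneq q ∞ p u v₁ v₂ C := by
  have hV0 := dualNorm_norm_preimage_ne_zero hn hp hp' hv₂
  set V : ℝ → ℝ≥0∞ := fun t =>
    dualNorm p (fun x => ENNReal.ofReal (v₂ x)) (norm ⁻¹' Set.Ici t) with hVdef
  set ω := hardyMeasure q u v₁
  have hV : Antitone V := fun s t hst =>
    dualNorm_mono p _ (Set.preimage_mono (Set.Ici_subset_Ici.2 hst))
  have hs : 0 ≤ r / p.toReal := by positivity
  have hDr : ∫⁻ t, ω (Set.Iio t) ^ (r / p.toReal) * V t ^ r ∂ω = D₂ q p r u v₁ v₂ ^ r := by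
    rw [D₂_eq hu, ← ENNReal.rpow_mul, one_div_mul_cancel hr.ne', ENNReal.rpow_one]
  -- If `ω (Iio T) = ∞`, then `∫_{t < T} ω (Iio t) ^ (r / p) dω = ∞`, while `V ≥ V T > 0` there.
  refine hardyIneq_of_lintegral_rpow_le hq hp' hu hv₁ (fun T hT => ?_) fun g hg => ?_
  · have h1 := rpow_half_measure_univ_le_lintegral (ω.restrict (Set.Iio T)) hs
    rw [Measure.restrict_apply_univ, hT, ENNReal.top_div_of_ne_top ENNReal.ofNat_ne_top,
      ENNReal.top_rpow_of_pos (by positivity), top_le_iff] at h1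
    have h2 : ∞ * V T ^ r ≤ D₂ q p r u v₁ v₂ ^ r := by
      rw [← hDr, ← h1, ← lintegral_mul_const _
        ((monotone_measure_Iio _).measurable.pow_const _)]
      refine (setLIntegral_mono' measurableSet_Iio fun t ht => ?_).trans
        (setLIntegral_le_lintegral _ _)
      gcongr
      · exact Measure.restrict_le_self
      · exact hV (le_of_lt ht)
    have hVr : V T ^ r ≠ 0 := by
      rw [Ne, ENNReal.rpow_eq_zero_iff_of_pos hr]
      exact hV0 T
    rw [ENNReal.top_mul hVr] at h2
    exact ENNReal.rpow_ne_top_of_nonneg hr.le hD (top_le_iff.1 h2)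
  · refine (lintegral_setLIntegral_rpow_le_of_lt hp hp' hq hr hrpq hv₂.aemeasurable_ofReal
      (fun _ => ENNReal.ofReal_ne_top) measurable_norm (volume_norm_preimage_singleton hn) hV0 hD
      hDr.le hg).trans ?_
    set K := (∫⁻ x, g x ^ p.toReal * ENNReal.ofReal (v₂ x)) ^ (1 / p.toReal)
    calc 2 * (4 * D₂ q p r u v₁ v₂ * K) ^ q
        = (2 ^ (1 / q) * 4 * D₂ q p r u v₁ v₂ * K) ^ q := by
          simp only [ENNReal.mul_rpow_of_nonneg _ _ hq.le, ← ENNReal.rpow_mul]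
          rw [one_div_mul_cancel hq.ne', ENNReal.rpow_one]
          ring
      _ ≤ _ := by gcongr

end Finite
end BilinearHardy

theorem mainTheorem4 (q : ℝ) (hq : 0 < q) (p₂ : ℝ≥0∞) (hp₂ : 1 ≤ p₂) :
    -- the equivalence constants depend only on `q` and `p₂`
    ∃ c₁ c₂ : ℝ≥0, 0 < c₁ ∧ 0 < c₂ ∧
      ∀ (n : ℕ) (_ : 1 ≤ n) (u : ℝ → ℝ) (v₁ v₂ : EuclideanSpace ℝ (Fin n) → ℝ),
        BilinearHardy.IsWeight (Set.Ioi 0) u →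
        BilinearHardy.IsWeight Set.univ v₁ →
        BilinearHardy.IsWeight Set.univ v₂ →
        -- (i)
        (p₂ ≤ ENNReal.ofReal q →
          ((∃ C : ℝ≥0, BilinearHardy.HardyIneq q ∞ p₂ u v₁ v₂ C) ↔
            BilinearHardy.D₁ q p₂ u v₁ v₂ < ∞) ∧
          c₁ * BilinearHardy.D₁ q p₂ u v₁ v₂ ≤ BilinearHardy.bestConstant q ∞ p₂ u v₁ v₂ ∧
          BilinearHardy.bestConstant q ∞ p₂ u v₁ v₂ ≤ c₂ * BilinearHardy.D₁ q p₂ u v₁ v₂) ∧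
        -- (ii)
        (ENNReal.ofReal q < p₂ → p₂ < ∞ → ∀ r₂ : ℝ, 1 / r₂ = 1 / q - 1 / p₂.toReal →
          ((∃ C : ℝ≥0, BilinearHardy.HardyIneq q ∞ p₂ u v₁ v₂ C) ↔
            BilinearHardy.D₂ q p₂ r₂ u v₁ v₂ < ∞) ∧
          c₁ * BilinearHardy.D₂ q p₂ r₂ u v₁ v₂ ≤ BilinearHardy.bestConstant q ∞ p₂ u v₁ v₂ ∧
          BilinearHardy.bestConstant q ∞ p₂ u v₁ v₂ ≤ c₂ * BilinearHardy.D₂ q p₂ r₂ u v₁ v₂) ∧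
        -- (iii)
        (p₂ = ∞ →
          ((∃ C : ℝ≥0, BilinearHardy.HardyIneq q ∞ p₂ u v₁ v₂ C) ↔
            BilinearHardy.D₃ q u v₁ v₂ < ∞) ∧
          c₁ * BilinearHardy.D₃ q u v₁ v₂ ≤ BilinearHardy.bestConstant q ∞ p₂ u v₁ v₂ ∧
          BilinearHardy.bestConstant q ∞ p₂ u v₁ v₂ ≤ c₂ * BilinearHardy.D₃ q u v₁ v₂) := by
  -- The same two constants serve all three cases.
  have hc₁ : (0 : ℝ≥0) < (2 ^ ((q + 2) / q))⁻¹ := by positivity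
  have hc₂ : (0 : ℝ≥0) < 2 ^ (1 / q) * 4 := by positivity
  have h2 : ((2 ^ ((q + 2) / q) : ℝ≥0) : ℝ≥0∞) = 2 ^ ((q + 2) / q) := by
    rw [ENNReal.coe_rpow_of_nonneg _ (by positivity)]; rfl
  have hcoe₁ : (((2 ^ ((q + 2) / q))⁻¹ : ℝ≥0) : ℝ≥0∞) = (2 ^ ((q + 2) / q))⁻¹ := by
    rw [ENNReal.coe_inv (by positivity), h2]
  have hcoe₂ : ((2 ^ (1 / q) * 4 : ℝ≥0) : ℝ≥0∞) = 2 ^ (1 / q) * 4 := by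
    rw [ENNReal.coe_mul, ENNReal.coe_rpow_of_nonneg _ (by positivity)]; rfl
  have hc₁le : (((2 ^ ((q + 2) / q))⁻¹ : ℝ≥0) : ℝ≥0∞) ≤ 1 := by
    rw [hcoe₁, ENNReal.inv_le_one]
    exact ENNReal.one_le_rpow one_le_two (by positivity)
  have h1le : (1 : ℝ≥0∞) ≤ 2 ^ (1 / q) := ENNReal.one_le_rpow one_le_two (by positivity)
  have hc₂4 : (4 : ℝ≥0∞) ≤ ((2 ^ (1 / q) * 4 : ℝ≥0) : ℝ≥0∞) := by
    rw [hcoe₂]; exact le_mul_of_one_le_left' h1le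
  refine ⟨_, _, hc₁, hc₂, fun n hn u v₁ v₂ hu hv₁ hv₂ =>
    ⟨fun hpq => ?_, fun hqp hp' r hr => ?_, ?_⟩⟩
  · have hp' : p₂ ≠ ∞ := ne_top_of_le_ne_top ENNReal.ofReal_ne_top hpq
    refine BilinearHardy.characterization_of_bounds hc₁ hc₂ (fun C hC => ?_) fun C hD hC => ?_
    · exact (mul_le_of_le_one_left' hc₁le).trans
        (BilinearHardy.D₁_le_of_hardyIneq hq hp₂ hp' hu hv₁ hv₂ hC)
    · refine BilinearHardy.hardyIneq_of_four_mul_D₁_le hn hq hp₂ hp'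
        ((ENNReal.le_ofReal_iff_toReal_le hp' hq.le).1 hpq) hu hv₁ hv₂ hD ?_
      rw [hC]
      gcongr
  · have hqp' : q < p₂.toReal := (ENNReal.ofReal_lt_iff_lt_toReal hq.le hp'.ne).1 hqp
    have hr0 : 0 < r := by
      rw [← one_div_pos, hr, sub_pos]
      exact one_div_lt_one_div_of_lt hq hqp'
    refine BilinearHardy.characterization_of_bounds hc₁ hc₂ (fun C hC => ?_) fun C hD hC => ?_
    · rw [hcoe₁, ENNReal.inv_mul_le_iff (by positivity) (by finiteness)]
      exact BilinearHardy.D₂_le_of_hardyIneq hn hq hp₂ hp'.ne hr0 hr hu hv₁ hv₂ hC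
    · exact BilinearHardy.hardyIneq_of_mul_D₂_le hn hq hp₂ hp'.ne hr0 hr hu hv₁ hv₂ hD
        (by rw [hC, hcoe₂])
  · rintro rfl
    refine BilinearHardy.characterization_of_bounds hc₁ hc₂ (fun C hC => ?_) fun C _ hC => ?_
    · exact (mul_le_of_le_one_left' hc₁le).trans
        (BilinearHardy.D₃_le_of_hardyIneq hq hu hv₁ hv₂ hC)
    · refine BilinearHardy.hardyIneq_of_D₃_le hn hq hu hv₁ hv₂ ?_
      rw [hC]
      exact le_mul_of_one_le_left' (le_trans (by norm_num) hc₂4)
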